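/- Let $\Bbbk$ be an algebraically closed field of characteristic $0$, let $m,n\ge 0$ be integers, and let $q\in\Bbbk$, $q\ne 0,\pm1$. Write $[r]=\frac{q^r-q^{-r}}{q-q^{-1}}$ and let $\mathbf{char}(q)$ be the least integer $\ell\ge 1$ with $[\ell]=0$, or $0$ if there is none. Put $I=\{1,\dots,m+n\}$, $I_0=\{1,\dots,m\}$, $I_1=I\setminus I_0$, $J=\{1,\dots,m+n-1\}$. On $\bigoplus_{i\in I}\mathbb Z\epsilon_i$ let $(\epsilon_i,\epsilon_j)=\delta_{ij}$ for $i\in I_0$ and $-\delta_{ij}$ for $i\in I_1$; put $\alpha_j=\epsilon_j-\epsilon_{j+1}$, $\omega_i=\epsilon_1+\cdots+\epsilon_i$ ($\omega_0=0$), and $q_i=q$ for $i\in I_0$, $q_i=q^{-1}$ for $i\in I_1$; let $p_j=\delta_{jm}$ ($j\in J$). **Algebras.** $\mathcal U_q(\mathfrak{gl}(m|n))$ is the associative algebra with generators $E_j,F_j$ $(j\in J)$, $K_i^{\pm1}$ $(i\in I)$, $\sigma$ and the relations, with $\mathcal K_j=K_jK_{j+1}^{-1}$: the $K_i$ commute and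 $K_iK_i^{-1}=K_i^{-1}K_i=1$; $K_iE_j=q^{(\epsilon_i,\alpha_j)}E_jK_i$, $K_iF_j=q^{-(\epsilon_i,\alpha_j)}F_jK_i$; $E_iF_j-(-1)^{p_ip_j}F_jE_i=\delta_{ij}\frac{\mathcal K_i-\mathcal K_i^{-1}}{q_i-q_i^{-1}}$; $X_iX_j=X_jX_i$ if $|i-j|>1$; $X_i^2X_j-(q+q^{-1})X_iX_jX_i+X_jX_i^2=0$ if $|i-j|=1$, $i\ne m$; $X_m^2=0$; and $X_{m-1}X_mX_{m+1}X_m+X_mX_{m-1}X_mX_{m+1}+X_{m+1}X_mX_{m-1}X_m+X_mX_{m+1}X_mX_{m-1}=(q+q^{-1})X_mX_{m-1}X_{m+1}X_m$ (the last four for $X=E$ and for $X=F$, whenever the indices lie in $J$); $\sigma^2=1$, $\sigma E_j\sigma=(-1)^{p_j}E_j$, $\sigma F_j\sigma=(-1)^{p_j}F_j$, $\sigma K_i\sigma=K_i$. This is the bosonization of the quantum superalgebra $U_q(\mathfrak{gl}(m|n))$. $\mathcal U_q(\mathfrak{sl}(m|n))$ is defined in the same way with generators $E_j,F_j,\mathcal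 K_j^{\pm1}$ $(j\in J)$, $\sigma$ and $\mathcal K_iE_j=q^{(\alpha_i,\alpha_j)}E_j\mathcal K_i$, $\mathcal K_iF_j=q^{-(\alpha_i,\alpha_j)}F_j\mathcal K_i$. If $\mathbf{char}(q)=\ell>2$, the restricted algebra $u_q$ is the quotient of $\mathcal U_q$ by $E_j^\ell=F_j^\ell=0$ $(j\ne m)$ and $K_i^{2\ell}=1$ (for $\mathfrak{sl}$: $\mathcal K_j^{2\ell}=1$). Below, $\mathcal U_q$ and $u_q$ are the algebras of either $\mathfrak{gl}(m|n)$ or $\mathfrak{sl}(m|n)$. **The quantum Grassmann superalgebra.** $\Omega_q(m|n)$ has the basis $x^{(\alpha)}\otimes x^\mu$, $\alpha\in\mathbb Z_{\ge0}^m$, $\mu\in\{0,1\}^n$, and the product $$(x^{(\alpha)}\otimes x^\mu)(x^{(\beta)}\otimes x^\nu)=q^{|\mu||\beta|+\alpha*\beta}(-q)^{\mu*\nu}\prod_{i=1}^m{\alpha_i+\beta_i\brack\alpha_i}\;x^{(\alpha+\beta)}\otimes x^{\mu+\nu},$$ where $a*b=\sum_{i>j}a_ib_j$, the brackets are Gaussian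 binomials at $q$, and $x^{\mu+\nu}=0$ if $\mu+\nu\notin\{0,1\}^n$. View $\langle\alpha,\mu\rangle$ as an element of $\mathbb Z^{m+n}$ (so $\mu$ has its coordinates $\mu_i$ at $i\in I_1$), and let $x_i$ be the monomial with exponent $\epsilon_i$. Let $\partial_i(x^{(\alpha)}\otimes x^\mu)$ be $q^{-\epsilon_i*\alpha}x^{(\alpha-\epsilon_i)}\otimes x^\mu$ for $i\in I_0$ and $q^{-|\alpha|}(-q)^{-\epsilon_i*\mu}x^{(\alpha)}\otimes x^{\mu-\epsilon_i}$ for $i\in I_1$ ($0$ if the $i$-th exponent is $0$); let $\sigma_i$ multiply $x^{(\alpha)}\otimes x^\mu$ by $q^{\alpha_i}$ ($i\in I_0$), by $(-q)^{\mu_i}$ ($i\in I_1$), and $\tau_i$ by $(-1)^{\mu_i}$ ($i\in I_1$). $\mathcal U_q$ acts on $\Omega_q(m|n)$ by $$E_j=x_j\partial_{j+1}\sigma_j,\quad F_j=\sigma_j^{-1}x_{j+1}\partial_j,\quad K_i=\sigma_i\ (i\in I_0),\quad K_i=(\sigma_i\tau_i)^{-1}\ (i\in I_1),\quad \mathcal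 K_j=K_jK_{j+1}^{-1},\quad \sigma(x^{(\alpha)}\otimes x^\mu)=(-1)^{|\mu|}x^{(\alpha)}\otimes x^\mu .$$ If $\mathbf{char}(q)=\ell>2$, the same operators give an action of $u_q$ on the span $\Omega_q(m|n,\mathbf 1)$ of the monomials with all $\alpha_i\le\ell-1$. Let $\Omega_q^{(t)}$ be the span of the monomials in $\Omega_q$ with $|\alpha|+|\mu|=t$. **Highest weight modules.** A highest weight vector of weight $\lambda=\sum\lambda_i\epsilon_i$ is a nonzero $v$ with $E_jv=0$, $K_iv=q^{(\lambda,\epsilon_i)}v$ (for $\mathfrak{sl}$: $\mathcal K_jv=q^{(\lambda,\alpha_j)}v$) and $\sigma v=(-1)^{\sum_{i\in I_1}\lambda_i}v$. $V(\lambda)$ is the simple highest weight module: the quotient of the universal module generated by a highest weight vector $v$ of weight $\lambda$ by its largest submodule contained in the span of all $F_{j_1}\cdots F_{j_r}v$, $r\ge1$. **Theorem.** Each $\Omega_q(m|n)^{(t)}$, $t\ge 0$, is a $\mathcal U_q$-submodule of $\Omega_q(m|n)$, and each $\Omega_q(m|n,\mathbf 1)^{(t)}$ is a $u_q$-submodule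 of $\Omega_q(m|n,\mathbf 1)$ when $\mathbf{char}(q)=\ell>2$. (i) If $\mathbf{char}(q)=0$ and $m\ge1$, then $\Omega_q(m|n)^{(t)}\cong V(t\omega_1)$ is a simple module, generated by the highest weight vector $x^{(t\epsilon_1)}\otimes1$ of weight $t\omega_1$. (ii) Let $\mathbf{char}(q)=\ell>2$ and $N=m(\ell-1)$. If $t=(i-1)(\ell-1)+t_i$ with $1\le i\le m$, $0\le t_i\le\ell-1$, then $\Omega_q(m|n,\mathbf 1)^{(t)}\cong V((\ell-1-t_i)\omega_{i-1}+t_i\omega_i)$ is a simple module, generated by the highest weight vector $x^{(\mathbf t)}\otimes1$ of this weight, where $\mathbf t=(\ell-1,\dots,\ell-1,t_i,0,\dots,0)$ with $i-1$ entries $\ell-1$ in front. If $t=N+p$ with $0\le p\le n$, then $\Omega_q(m|n,\mathbf 1)^{(t)}\cong V((\ell-2)\omega_m+\omega_{m+p})$ is a simple module, generated by the highest weight vector $x^{(\ell-1,\dots,\ell-1)}\otimes x_{m+1}\cdots x_{m+p}$ of this weight. -/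

import Mathlib

noncomputable section

namespace QGrassmann

/-! ## Quantum integers -/

/-- The quantum integer `[n] = (q^n - q^(-n)) / (q - q^(-1))` (for `q ≠ ±1`). -/
def qInt {k : Type*} [Field k] (q : k) (n : ℕ) : k :=
  (q ^ n - (q ^ n)⁻¹) / (q - q⁻¹)

/-- The Gaussian binomial coefficient (the evaluation at `v = q` of the Laurent polynomial
`[n]! / ([r]! [n-r]!)`), defined through the `q`-Pascal rule
`[n+1, r+1] = q^(r-n) [n, r] + q^(r+1) [n, r+1]`, so that it makes sense at roots of unity. -/
def qBinom {k : Type*} [Field k] (q : k) : ℕ → ℕ → k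
  | _, 0 => 1
  | 0, _ + 1 => 0
  | n + 1, r + 1 =>
      q ^ ((r : ℤ) - (n : ℤ)) * qBinom q n r + q ^ (r + 1) * qBinom q n (r + 1)

/-- The characteristic of `q`: the least positive integer `ℓ` with `[ℓ] = 0`, and `0` if there
is none, i.e. if `q` is generic (the infimum of the empty set of natural numbers is `0`). -/
def qChar {k : Type*} [Field k] (q : k) : ℕ :=
  sInf {l : ℕ | 0 < l ∧ qInt q l = 0}

/-! ## Weights of `gl(m|n)`

The index set is `I = Fin (m + n)`, starting at `0`: the even indices `I₀` are those `< m`, the odd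
ones `I₁` are those `≥ m`. The simple roots are indexed by `J = Fin (m + n - 1)`; the simple root
with index `j` is `ε_j - ε_(j+1)`, and it is odd exactly if `j + 1 = m`. -/

/-- The lower index `j` of the simple root `ε_j - ε_(j+1)`. -/
def lo {m n : ℕ} (j : Fin (m + n - 1)) : Fin (m + n) := ⟨j.1, by omega⟩

/-- The upper index `j + 1` of the simple root `ε_j - ε_(j+1)`. -/
def hi {m n : ℕ} (j : Fin (m + n - 1)) : Fin (m + n) := ⟨j.1 + 1, by omega⟩

/-- The unique odd simple root is the one between the last even and the first odd index. -/
def IsOdd {m n : ℕ} (j : Fin (m + n - 1)) : Prop := j.1 + 1 = m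

instance {m n : ℕ} (j : Fin (m + n - 1)) : Decidable (IsOdd j) :=
  inferInstanceAs (Decidable (j.1 + 1 = m))

/-- The parity `p(E_j) = p(F_j)`. -/
def par {m n : ℕ} (j : Fin (m + n - 1)) : ℕ := if IsOdd j then 1 else 0

/-- The integral weight lattice, in the coordinates `ε_i`. -/
abbrev Weight (m n : ℕ) : Type := Fin (m + n) → ℤ

/-- The supertrace form: `(ε_i, ε_i) = 1` for `i` even and `-1` for `i` odd. -/
def form {m n : ℕ} (a b : Weight m n) : ℤ :=
  ∑ i, (if i.1 < m then 1 else -1) * a i * b i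

/-- The simple root `α_j = ε_j - ε_(j+1)`. -/
def simpleRoot {m n : ℕ} (j : Fin (m + n - 1)) : Weight m n :=
  Pi.single (lo j) 1 - Pi.single (hi j) 1

/-- The fundamental weight `ω_r`, the sum of the first `r` of the `ε_i` (so `ω_0 = 0`). -/
def fundWeight (m n r : ℕ) : Weight m n := fun i => if i.1 < r then 1 else 0

/-- The odd degree of a weight, the sum of its coordinates at the odd indices. Its parity is the
`ℤ/2`-degree of the vectors of this weight. -/
def oddDegree {m n : ℕ} (a : Weight m n) : ℤ := ∑ i, if m ≤ i.1 then a i else 0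

/-! ## The quantum superalgebras and their bosonizations -/

/-- The two series: general linear and special linear. -/
inductive LieType : Type
  | gl
  | sl

/-- The index set of the torus generators: `K_i`, `i ∈ I`, for `gl`, and the
`𝒦_j = K_j K_(j+1)⁻¹`, `j ∈ J`, for `sl`. -/
def LieType.Torus (g : LieType) (m n : ℕ) : Type :=
  match g with
  | .gl => Fin (m + n)
  | .sl => Fin (m + n - 1)

/-- The weight attached to a torus generator: `ε_i` to `K_i` and `α_j` to `𝒦_j`. The generator
attached to `β` acts on a vector of weight `γ` as `q ^ (β, γ)`. -/
def torusWeight {m n : ℕ} : (g : LieType) → g.Torus m n → Weight m n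
  | .gl, i => Pi.single (show Fin (m + n) from i) 1
  | .sl, j => simpleRoot (show Fin (m + n - 1) from j)

/-- Generators: `E_j`, `F_j`, the torus generators, their inverses, and the parity element. -/
inductive Gen (g : LieType) (m n : ℕ) : Type
  | E (j : Fin (m + n - 1))
  | F (j : Fin (m + n - 1))
  | T (i : g.Torus m n)
  | Tinv (i : g.Torus m n)
  | sigma

/-- `q_i = q` for `i` even, `q_i = q⁻¹` for `i` odd. -/
def qSub {k : Type*} [Field k] (q : k) (m i : ℕ) : k := if i < m then q else q⁻¹

section Presentation

variable (k : Type*) [Field k] (g : LieType) (m n : ℕ)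

/-- Free generator `E_j`. -/
def fE (j : Fin (m + n - 1)) : FreeAlgebra k (Gen g m n) := FreeAlgebra.ι k (Gen.E j)
/-- Free generator `F_j`. -/
def fF (j : Fin (m + n - 1)) : FreeAlgebra k (Gen g m n) := FreeAlgebra.ι k (Gen.F j)
/-- Free torus generator. -/
def fT (i : g.Torus m n) : FreeAlgebra k (Gen g m n) := FreeAlgebra.ι k (Gen.T i)
/-- Free inverse torus generator. -/
def fTinv (i : g.Torus m n) : FreeAlgebra k (Gen g m n) := FreeAlgebra.ι k (Gen.Tinv i)
/-- Free parity element. -/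
def fSigma : FreeAlgebra k (Gen g m n) := FreeAlgebra.ι k Gen.sigma

/-- `𝒦_j`: it is `K_j K_(j+1)⁻¹` for `gl` and a generator for `sl`. -/
def fCalK : (g : LieType) → Fin (m + n - 1) → FreeAlgebra k (Gen g m n)
  | .gl, j => fT k .gl m n (lo j) * fTinv k .gl m n (hi j)
  | .sl, j => fT k .sl m n j

/-- `𝒦_j⁻¹`: it is `K_(j+1) K_j⁻¹` for `gl` and a generator for `sl`. -/
def fCalKinv : (g : LieType) → Fin (m + n - 1) → FreeAlgebra k (Gen g m n)
  | .gl, j => fT k .gl m n (hi j) * fTinv k .gl m n (lo j)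
  | .sl, j => fTinv k .sl m n j

end Presentation

/-- The defining relations. For `l = 0` these are the relations of the bosonization
`U_q(g) # k[ℤ/2]` of the quantum superalgebra, `g = gl(m|n)` or `sl(m|n)`. For `l > 0` the relations
`E_j^l = F_j^l = 0` (`j` even) and `K^(2l) = 1` of the restricted quotient are added. -/
inductive Rel {k : Type*} [Field k] (g : LieType) (l : ℕ) (q : k) (m n : ℕ) :
    FreeAlgebra k (Gen g m n) → FreeAlgebra k (Gen g m n) → Prop
  -- the torus
  | T_comm (a b : g.Torus m n) :
      Rel g l q m n (fT k g m n a * fT k g m n b) (fT k g m n b * fT k g m n a)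
  | T_Tinv (a : g.Torus m n) : Rel g l q m n (fT k g m n a * fTinv k g m n a) 1
  | Tinv_T (a : g.Torus m n) : Rel g l q m n (fTinv k g m n a * fT k g m n a) 1
  | T_E (a : g.Torus m n) (j : Fin (m + n - 1)) :
      Rel g l q m n (fT k g m n a * fE k g m n j)
        (q ^ form (torusWeight g a) (simpleRoot j) • (fE k g m n j * fT k g m n a))
  | T_F (a : g.Torus m n) (j : Fin (m + n - 1)) :
      Rel g l q m n (fT k g m n a * fF k g m n j)
        (q ^ (-form (torusWeight g a) (simpleRoot j)) • (fF k g m n j * fT k g m n a))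
  -- the super-commutators of the `E_i` and `F_j`
  | E_F_same (i : Fin (m + n - 1)) :
      Rel g l q m n
        (fE k g m n i * fF k g m n i - (-1 : k) ^ (par i * par i) • (fF k g m n i * fE k g m n i))
        ((qSub q m i.1 - (qSub q m i.1)⁻¹)⁻¹ • (fCalK k m n g i - fCalKinv k m n g i))
  | E_F_diff (i j : Fin (m + n - 1)) (h : i ≠ j) :
      Rel g l q m n
        (fE k g m n i * fF k g m n j - (-1 : k) ^ (par i * par j) • (fF k g m n j * fE k g m n i)) 0
  -- Serre relations
  | E_comm (i j : Fin (m + n - 1)) (h : i.1 + 1 < j.1 ∨ j.1 + 1 < i.1) :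
      Rel g l q m n (fE k g m n i * fE k g m n j) (fE k g m n j * fE k g m n i)
  | F_comm (i j : Fin (m + n - 1)) (h : i.1 + 1 < j.1 ∨ j.1 + 1 < i.1) :
      Rel g l q m n (fF k g m n i * fF k g m n j) (fF k g m n j * fF k g m n i)
  | E_serre (i j : Fin (m + n - 1)) (h : i.1 + 1 = j.1 ∨ j.1 + 1 = i.1) (hi : ¬ IsOdd i) :
      Rel g l q m n
        (fE k g m n i * fE k g m n i * fE k g m n j
          - (q + q⁻¹) • (fE k g m n i * fE k g m n j * fE k g m n i)
          + fE k g m n j * fE k g m n i * fE k g m n i) 0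
  | F_serre (i j : Fin (m + n - 1)) (h : i.1 + 1 = j.1 ∨ j.1 + 1 = i.1) (hi : ¬ IsOdd i) :
      Rel g l q m n
        (fF k g m n i * fF k g m n i * fF k g m n j
          - (q + q⁻¹) • (fF k g m n i * fF k g m n j * fF k g m n i)
          + fF k g m n j * fF k g m n i * fF k g m n i) 0
  | E_odd (i : Fin (m + n - 1)) (hi : IsOdd i) : Rel g l q m n (fE k g m n i * fE k g m n i) 0
  | F_odd (i : Fin (m + n - 1)) (hi : IsOdd i) : Rel g l q m n (fF k g m n i * fF k g m n i) 0
  -- `a, b, c` are three consecutive indices, the middle one odd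
  | E_super (a b c : Fin (m + n - 1)) (hab : a.1 + 1 = b.1) (hbc : b.1 + 1 = c.1) (hb : IsOdd b) :
      Rel g l q m n
        (fE k g m n a * fE k g m n b * fE k g m n c * fE k g m n b
          + fE k g m n b * fE k g m n a * fE k g m n b * fE k g m n c
          + fE k g m n c * fE k g m n b * fE k g m n a * fE k g m n b
          + fE k g m n b * fE k g m n c * fE k g m n b * fE k g m n a
          - (q + q⁻¹) • (fE k g m n b * fE k g m n a * fE k g m n c * fE k g m n b)) 0
  | F_super (a b c : Fin (m + n - 1)) (hab : a.1 + 1 = b.1) (hbc : b.1 + 1 = c.1) (hb : IsOdd b) :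
      Rel g l q m n
        (fF k g m n a * fF k g m n b * fF k g m n c * fF k g m n b
          + fF k g m n b * fF k g m n a * fF k g m n b * fF k g m n c
          + fF k g m n c * fF k g m n b * fF k g m n a * fF k g m n b
          + fF k g m n b * fF k g m n c * fF k g m n b * fF k g m n a
          - (q + q⁻¹) • (fF k g m n b * fF k g m n a * fF k g m n c * fF k g m n b)) 0
  -- the parity element
  | sigma_sq : Rel g l q m n (fSigma k g m n * fSigma k g m n) 1
  | sigma_E (j : Fin (m + n - 1)) :
      Rel g l q m n (fSigma k g m n * fE k g m n j * fSigma k g m n)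
        ((-1 : k) ^ par j • fE k g m n j)
  | sigma_F (j : Fin (m + n - 1)) :
      Rel g l q m n (fSigma k g m n * fF k g m n j * fSigma k g m n)
        ((-1 : k) ^ par j • fF k g m n j)
  | sigma_T (a : g.Torus m n) :
      Rel g l q m n (fSigma k g m n * fT k g m n a * fSigma k g m n) (fT k g m n a)
  -- the restricted relations
  | res_E (hl : 0 < l) (j : Fin (m + n - 1)) (hj : ¬ IsOdd j) : Rel g l q m n (fE k g m n j ^ l) 0
  | res_F (hl : 0 < l) (j : Fin (m + n - 1)) (hj : ¬ IsOdd j) : Rel g l q m n (fF k g m n j ^ l) 0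
  | res_T (hl : 0 < l) (a : g.Torus m n) : Rel g l q m n (fT k g m n a ^ (2 * l)) 1

/-- The associative algebra given by the generators and relations above: `l = 0` is the bosonized
quantum superalgebra `𝒰_q(g)`, and `l > 0` its restricted quotient `u_q(g)`. -/
abbrev QAlg {k : Type*} [Field k] (g : LieType) (l : ℕ) (q : k) (m n : ℕ) : Type _ :=
  RingQuot (Rel g l q m n)

section Generators

variable {k : Type*} [Field k] (g : LieType) (l : ℕ) (q : k) (m n : ℕ)

/-- The image of a free generator in the algebra. -/
def gen (x : Gen g m n) : QAlg g l q m n :=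
  RingQuot.mkAlgHom k (Rel g l q m n) (FreeAlgebra.ι k x)

/-! ## Highest weight modules -/

/-- The left ideal generated by the `E_j`, the `K - q ^ (β, lam)` (`K` the torus generator attached
to `β`), and `σ - (-1) ^ (odd degree of lam)`. -/
def vermaIdeal (lam : Weight m n) : Submodule (QAlg g l q m n) (QAlg g l q m n) :=
  Submodule.span _
    ((Set.range fun j => gen g l q m n (.E j)) ∪
      (Set.range fun a => gen g l q m n (.T a) -
        algebraMap k _ (q ^ form (torusWeight g a) lam)) ∪
      {gen g l q m n .sigma - algebraMap k _ ((-1 : k) ^ oddDegree lam)})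

/-- The universal highest weight module (Verma module) of highest weight `lam`. -/
abbrev Verma (lam : Weight m n) : Type _ := QAlg g l q m n ⧸ vermaIdeal g l q m n lam

/-- The part of the Verma module below its highest weight: the `k`-span of all
`F_(j₁) ⋯ F_(jᵣ) v` with `r ≥ 1`, where `v` is the canonical generator. -/
def vermaLower (lam : Weight m n) : Submodule k (Verma g l q m n lam) :=
  Submodule.span k
    {x | ∃ w : List (Fin (m + n - 1)), w ≠ [] ∧
      x = (w.map fun j => gen g l q m n (.F j)).prod •
        (Submodule.Quotient.mk 1 : Verma g l q m n lam)}

/-- The largest submodule of the Verma module that lies below the highest weight. -/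
def vermaRadical (lam : Weight m n) : Submodule (QAlg g l q m n) (Verma g l q m n lam) :=
  sSup {N | ∀ x ∈ N, x ∈ vermaLower g l q m n lam}

/-- The simple highest weight module `V(lam)`: the quotient of the Verma module by the largest
submodule below the highest weight. For generic `q`, and whenever the augmentation ideal of the
subalgebra of the `F_j` is nilpotent, every proper submodule of a Verma module lies below the highest
weight, and this is the quotient by the unique maximal submodule. -/
abbrev V (lam : Weight m n) : Type _ := Verma g l q m n lam ⧸ vermaRadical g l q m n lam

variable {M : Type*} [AddCommGroup M] [Module k M] [Module (QAlg g l q m n) M]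

/-- `v` is a highest weight vector of weight `lam`. -/
def IsHighestWeightVector (lam : Weight m n) (v : M) : Prop :=
  v ≠ 0 ∧
  (∀ j, gen g l q m n (.E j) • v = 0) ∧
  (∀ a, gen g l q m n (.T a) • v = q ^ form (torusWeight g a) lam • v) ∧
  gen g l q m n .sigma • v = (-1 : k) ^ oddDegree lam • v

/-- `W` is simple, it is generated by the highest weight vector `v` of weight `lam`, and it is
isomorphic to `V(lam)`. -/
def IsSimpleHighestWeight (W : Submodule (QAlg g l q m n) M) (v : M) (lam : Weight m n) : Prop :=
  IsSimpleModule (QAlg g l q m n) W ∧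
  IsHighestWeightVector g l q m n lam v ∧
  W = Submodule.span (QAlg g l q m n) {v} ∧
  Nonempty (W ≃ₗ[QAlg g l q m n] V g l q m n lam)

end Generators

/-! ## The quantum Grassmann superalgebra -/

/-- The exponents `⟨α, μ⟩ ∈ ℕ^m × {0,1}^n` of the monomials `x^(α) ⊗ x^μ`. -/
abbrev Expo (m n : ℕ) : Type := {a : Fin (m + n) → ℕ // ∀ i, m ≤ i.1 → a i ≤ 1}

/-- The underlying space of `Ω_q(m|n)`, the tensor product of the quantum divided power algebra
`𝒜_q(m)` and the quantum exterior algebra `Λ_(q⁻¹)(n)`, with the basis of the `x^(α) ⊗ x^μ`. -/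
abbrev Omega (k : Type*) [Field k] (m n : ℕ) : Type _ := Expo m n →₀ k

section Operators

variable {k : Type*} [Field k] (q : k) {m n : ℕ}

/-- The monomial `x^(α) ⊗ x^μ` with exponent `a = ⟨α, μ⟩`; it is `0` if `μ` is not in `{0,1}^n`. -/
def mono (k : Type*) [Field k] {m n : ℕ} (a : Fin (m + n) → ℕ) : Omega k m n :=
  open Classical in
  if h : ∀ i, m ≤ i.1 → a i ≤ 1 then Finsupp.single ⟨a, h⟩ 1 else 0

/-- `a * b = ∑_(i > j) a_i b_j`. -/
def starProd (a b : Fin (m + n) → ℕ) : ℕ := ∑ i, ∑ j, if j < i then a i * b j else 0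

/-- `μ * ν`, the part of `a * b` in which both indices are odd. -/
def oddStarProd (a b : Fin (m + n) → ℕ) : ℕ :=
  ∑ i, ∑ j, if j < i ∧ m ≤ j.1 then a i * b j else 0

/-- The structure constant of the product of two monomials. -/
def mulCoeff (a b : Fin (m + n) → ℕ) : k :=
  q ^ starProd a b * (-1) ^ oddStarProd a b *
    ∏ i : Fin (m + n), if i.1 < m then qBinom q (a i + b i) (a i) else 1

/-- The product of `Ω_q(m|n)`: with `a = ⟨α, μ⟩` and `b = ⟨β, ν⟩`,
`(x^(α) ⊗ x^μ)(x^(β) ⊗ x^ν) = q^(μ*β) x^(α) x^(β) ⊗ x^μ x^ν`, where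
`x^(α) x^(β) = q^(α*β) [α+β, α] x^(α+β)` and `x^μ x^ν = (-q)^(μ*ν) x^(μ+ν)`. -/
def mulΩ : Omega k m n →ₗ[k] Omega k m n →ₗ[k] Omega k m n :=
  Finsupp.linearCombination k fun a : Expo m n =>
    Finsupp.linearCombination k fun b : Expo m n => mulCoeff q a.1 b.1 • mono k (a.1 + b.1)

/-- The operator `x_i` of left multiplication by the `i`-th generator. -/
def opX (i : Fin (m + n)) : Omega k m n →ₗ[k] Omega k m n := mulΩ q (mono k (Pi.single i 1))

/-- The `q`-derivative `∂_i`: it sends `x^(β) ⊗ x^μ` to `q^(-ε_i*β) x^(β-ε_i) ⊗ x^μ` for `i` even and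
to `q^(-ε_i*β) (-q)^(-ε_i*μ) x^(β) ⊗ x^(μ-ε_i)` for `i` odd (to `0` if the `i`-th exponent is `0`). -/
def opD (i : Fin (m + n)) : Omega k m n →ₗ[k] Omega k m n :=
  Finsupp.linearCombination k fun a : Expo m n =>
    if a.1 i = 0 then 0
    else (q ^ starProd (Pi.single i 1) a.1 * (-1) ^ oddStarProd (Pi.single i 1) a.1)⁻¹ •
      mono k (a.1 - Pi.single i 1)

/-- The operator that multiplies each monomial by a scalar. -/
def diag (c : Expo m n → k) : Omega k m n →ₗ[k] Omega k m n :=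
  Finsupp.linearCombination k fun a : Expo m n => Finsupp.single a (c a)

/-- `σ_i`: it multiplies a monomial by `q^(α_i)` for `i` even and by `(-q)^(μ_i)` for `i` odd. -/
def opSigma (i : Fin (m + n)) : Omega k m n →ₗ[k] Omega k m n :=
  diag fun a => (if i.1 < m then q else -q) ^ a.1 i

/-- `σ_i⁻¹`. -/
def opSigmaInv (i : Fin (m + n)) : Omega k m n →ₗ[k] Omega k m n :=
  diag fun a => ((if i.1 < m then q else -q) ^ a.1 i)⁻¹

/-- `τ_i` (used for `i` odd): it multiplies a monomial by `(-1)^(μ_i)`. It is its own inverse. -/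
def opTau (i : Fin (m + n)) : Omega k m n →ₗ[k] Omega k m n :=
  diag fun a => (-1) ^ a.1 i

/-- The parity automorphism: it multiplies `x^(α) ⊗ x^μ` by `(-1)^|μ|`. -/
def opParity : Omega k m n →ₗ[k] Omega k m n :=
  diag fun a => (-1) ^ ∑ i, if m ≤ i.1 then a.1 i else 0

/-- `E_j = x_j ∂_(j+1) σ_j`. -/
def opE (j : Fin (m + n - 1)) : Omega k m n →ₗ[k] Omega k m n :=
  opX q (lo j) ∘ₗ opD q (hi j) ∘ₗ opSigma q (lo j)

/-- `F_j = σ_j⁻¹ x_(j+1) ∂_j`. -/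
def opF (j : Fin (m + n - 1)) : Omega k m n →ₗ[k] Omega k m n :=
  opSigmaInv q (lo j) ∘ₗ opX q (hi j) ∘ₗ opD q (lo j)

/-- `K_i = σ_i` for `i` even and `K_i = (σ_i τ_i)⁻¹` for `i` odd. -/
def opK (i : Fin (m + n)) : Omega k m n →ₗ[k] Omega k m n :=
  if i.1 < m then opSigma q i else opTau i ∘ₗ opSigmaInv q i

/-- `K_i⁻¹ = σ_i⁻¹` for `i` even and `K_i⁻¹ = σ_i τ_i` for `i` odd. -/
def opKinv (i : Fin (m + n)) : Omega k m n →ₗ[k] Omega k m n :=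
  if i.1 < m then opSigmaInv q i else opSigma q i ∘ₗ opTau i

/-- The torus generators: `K_i` for `gl`, and `𝒦_j = K_j K_(j+1)⁻¹` for `sl`. -/
def opT : (g : LieType) → g.Torus m n → (Omega k m n →ₗ[k] Omega k m n)
  | .gl, i => opK q (show Fin (m + n) from i)
  | .sl, j => opK q (lo j) ∘ₗ opKinv q (hi j)

/-- A module `M`, embedded into `Ω_q(m|n)` by `ι`, on which the generators of the algebra act through
the quantum differential operators above. -/
def ActsByOperators (g : LieType) (l : ℕ) (M : Type*) [AddCommGroup M] [Module k M]
    [Module (QAlg g l q m n) M] (ι : M →ₗ[k] Omega k m n) : Prop :=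
  (∀ j x, ι (gen g l q m n (.E j) • x) = opE q j (ι x)) ∧
  (∀ j x, ι (gen g l q m n (.F j) • x) = opF q j (ι x)) ∧
  (∀ a x, ι (gen g l q m n (.T a) • x) = opT q g a (ι x)) ∧
  (∀ x, ι (gen g l q m n .sigma • x) = opParity (ι x))

end Operators

/-- The homogeneous component `Ω_q(m|n)^(t)`, spanned by the monomials with `|α| + |μ| = t`. -/
def component (k : Type*) [Field k] (m n t : ℕ) : Submodule k (Omega k m n) :=
  Submodule.span k {x | ∃ a : Expo m n, ∑ i, a.1 i = t ∧ x = mono k a.1}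

/-- The quantum restricted Grassmann superalgebra `Ω_q(m|n, 1)`, spanned by the monomials
`x^(α) ⊗ x^μ` with `α_i ≤ l - 1` for all `i`. -/
def restricted (k : Type*) [Field k] (l m n : ℕ) : Submodule k (Omega k m n) :=
  Submodule.span k {x | ∃ a : Expo m n, (∀ i, i.1 < m → a.1 i < l) ∧ x = mono k a.1}

/-- The homogeneous component `Ω_q(m|n, 1)^(t)`. -/
def restrictedComponent (k : Type*) [Field k] (l m n t : ℕ) :
    Submodule k (restricted k l m n) :=
  (component k m n t).comap (restricted k l m n).subtype

/-- The exponent `(l-1, …, l-1, s, 0, …, 0)` with `r` entries `l - 1`. -/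
def stairExpo (l m n r s : ℕ) : Fin (m + n) → ℕ :=
  fun i => if i.1 < r then l - 1 else if i.1 = r then s else 0

/-- The exponent of `x^(τ(m)) ⊗ x_(m+1) ⋯ x_(m+p)`, where `τ(m) = (l-1, …, l-1)`. -/
def topExpo (l m n p : ℕ) : Fin (m + n) → ℕ :=
  fun i => if i.1 < m then l - 1 else if i.1 < m + p then 1 else 0

end QGrassmann

end

open QGrassmann

/-! The representation and the simplicity of its components come from undoing the twists.

On a monomial `x^b` with exponents `b` all powers of `q` and all signs in `x_j ∂_(j+1) σ_j` and
`σ_j⁻¹ x_(j+1) ∂_j` cancel. Hence `E_j = X_j D_(j+1)` and `F_j = X_(j+1) D_j` (`opE_eq`, `opF_eq`),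
where `X_i` and `D_i` (`raise`, `lower`) change the `i`-th exponent alone, with the coefficient
`[b_i + 1]` for `X_i` at an even place. Operators at different places commute. At an even place they
satisfy two cubic relations coming from `[x] + [x + 2] = (q + q⁻¹) [x + 1]`; at an odd place their
squares vanish. All defining relations follow from these facts (`lift_genOp_of_rel`), the Serre
relations through the identities `serre_of_commute` and `super_serre_of_commute` in an arbitrary
algebra. If `[l] = 0`, the restricted relations hold as well, and the exponents `< l` span an
invariant subspace.

Since `E_j` moves one unit from the place `j + 1` to the place `j`, distinct monomials have distinct
images up to scalars, so a vector is killed by all `E_j` only if each of its monomials is. Such a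
monomial is a staircase: the places before a nonzero exponent are filled up. A staircase is
determined by its degree (`IsStair.eq_of_sum_eq`, `exists_raisable`). Every `E_j` decreases the
height `∑ i b_i`, so every nonzero submodule of a homogeneous component contains the monomial of the
staircase (`stair_mem_of_ne_bot`), and running the moves backwards with the `F_j` shows that it
generates the component (`eq_span_stair`). No separation of weights is needed; for `sl` it would
fail, since distinct monomials of the same degree can have the same weight.

Finally, a Verma module is spanned by its generator and the part below the highest weight
(`exists_sub_mem_vermaLower`). In the component, the height separates the highest weight vector `v`
from all `F_(j₁) ⋯ F_(jᵣ) v` with `r ≥ 1`; hence the kernel of the map from the Verma module lies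
below the highest weight, and by simplicity it contains every other such submodule
(`nonempty_equiv_V`). The highest weight is the exponent of the staircase. -/

noncomputable section

namespace QGrassmann

/-! ### Quantum integers -/

section QuantumIntegers

variable {k : Type*} [Field k] {q : k}

lemma sub_inv_ne_zero_of_ne (hq0 : q ≠ 0) (hq1 : q ≠ 1) (hq2 : q ≠ -1) : q - q⁻¹ ≠ 0 := by
  intro h
  have h1 : (q - 1) * (q + 1) = 0 := by
    have : (q - q⁻¹) * q = 0 := by rw [h, zero_mul]
    rw [sub_mul, inv_mul_cancel₀ hq0] at this
    linear_combination this
  rcases mul_eq_zero.1 h1 with h2 | h2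
  · exact hq1 (sub_eq_zero.1 h2)
  · exact hq2 (eq_neg_of_add_eq_zero_left h2)

@[simp] lemma qInt_zero : qInt q 0 = 0 := by simp [qInt]

lemma qInt_add_qInt (hq0 : q ≠ 0) (x : ℕ) :
    qInt q x + qInt q (x + 2) = (q + q⁻¹) * qInt q (x + 1) := by
  simp only [qInt, pow_add, div_eq_mul_inv]
  field_simp
  ring

lemma qInt_mul_succ_sub (hq0 : q ≠ 0) (hq : q - q⁻¹ ≠ 0) (x y : ℕ) :
    qInt q x * qInt q (y + 1) - qInt q (x + 1) * qInt q y =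
      (q - q⁻¹)⁻¹ * (q ^ ((x : ℤ) - y) - q ^ ((y : ℤ) - x)) := by
  have h : (q - q⁻¹) ≠ 0 := hq
  have e : ∀ z : ℕ, qInt q z = (q - q⁻¹)⁻¹ * (q ^ z - (q ^ z)⁻¹) := fun z => by
    rw [qInt, div_eq_mul_inv, mul_comm]
  have hm : (q - q⁻¹)⁻¹ * (q - q⁻¹) = 1 := inv_mul_cancel₀ h
  rw [e, e, e, e, zpow_sub₀ hq0, zpow_sub₀ hq0]
  simp only [zpow_natCast]
  have key : (q ^ x - (q ^ x)⁻¹) * (q ^ (y + 1) - (q ^ (y + 1))⁻¹)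
      - (q ^ (x + 1) - (q ^ (x + 1))⁻¹) * (q ^ y - (q ^ y)⁻¹)
      = (q - q⁻¹) * (q ^ x / q ^ y - q ^ y / q ^ x) := by
    simp only [pow_succ]
    field_simp
    ring
  linear_combination (q - q⁻¹)⁻¹ ^ 2 * key
    + (q - q⁻¹)⁻¹ * (q ^ x / q ^ y - q ^ y / q ^ x) * hm

lemma pow_two_mul_eq_one_of_qInt_eq_zero (hq0 : q ≠ 0) (hq : q - q⁻¹ ≠ 0) {l : ℕ}
    (hl : qInt q l = 0) : q ^ (2 * l) = 1 := by
  have h1 : q ^ l - (q ^ l)⁻¹ = 0 := by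
    rw [qInt, div_eq_zero_iff] at hl
    exact hl.resolve_right hq
  have h2 : q ^ l * (q ^ l)⁻¹ = 1 := mul_inv_cancel₀ (pow_ne_zero _ hq0)
  rw [two_mul, pow_add]
  linear_combination q ^ l * h1 + h2

lemma qInt_mul_eq_zero (hq0 : q ≠ 0) (hq : q - q⁻¹ ≠ 0) {l : ℕ} (hl : qInt q l = 0) (r : ℕ) :
    qInt q (l * r) = 0 := by
  have h := pow_two_mul_eq_one_of_qInt_eq_zero hq0 hq hl
  have h3 : q ^ (l * r) * q ^ (l * r) = 1 := by
    rw [← pow_add, ← two_mul, ← mul_assoc, pow_mul, h, one_pow]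
  rw [qInt, ← eq_inv_of_mul_eq_one_left h3, sub_self, zero_div]

lemma qBinom_zero_right (x : ℕ) : qBinom q x 0 = 1 := by
  cases x <;> simp [qBinom]

lemma qBinom_one_right (hq0 : q ≠ 0) (hq : q - q⁻¹ ≠ 0) (x : ℕ) :
    qBinom q x 1 = qInt q x := by
  induction x with
  | zero => simp [qBinom]
  | succ x ih =>
    rw [qBinom, ih, qBinom_zero_right]
    have hm : (q - q⁻¹)⁻¹ * (q - q⁻¹) = 1 := inv_mul_cancel₀ hq
    have hx : q ^ x * (q ^ x)⁻¹ = 1 := mul_inv_cancel₀ (pow_ne_zero _ hq0)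
    simp only [qInt, pow_succ, mul_inv, div_eq_mul_inv, Nat.cast_zero, zero_sub, zpow_neg,
      zpow_natCast, pow_zero, one_mul]
    linear_combination (-(q ^ x)⁻¹) * hm

/-- The numbers `[r]`, `0 < r`, that are smaller than a bound `l` do not vanish; `l = 0` stands for
no bound. -/
lemma qInt_ne_zero_of_qChar {l r : ℕ} (hl : qChar q = l) (hr : 0 < r) (hrl : l = 0 ∨ r < l) :
    qInt q r ≠ 0 := by
  intro h
  have hmem : r ∈ {l : ℕ | 0 < l ∧ qInt q l = 0} := ⟨hr, h⟩
  rcases hrl with rfl | hrl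
  · rcases Nat.sInf_eq_zero.1 hl with h0 | h0
    · exact absurd h0.1 (lt_irrefl 0)
    · rw [h0] at hmem
      exact hmem
  · rw [← hl] at hrl
    exact Nat.notMem_of_lt_sInf hrl hmem

lemma qInt_qChar {l : ℕ} (hl : qChar q = l) : qInt q l = 0 := by
  rcases Nat.eq_zero_or_pos l with rfl | h
  · exact qInt_zero
  · have : sInf {l : ℕ | 0 < l ∧ qInt q l = 0} = l := hl
    have hm := Nat.sInf_mem (Nat.nonempty_of_pos_sInf (this ▸ h))
    rw [this] at hm
    exact hm.2

end QuantumIntegers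

/-! ### Raising and lowering operators at a single site -/

section SiteOperators

variable {k : Type*} [Field k] {m n : ℕ}

lemma mono_of_valid (a : Expo m n) : mono k a.1 = Finsupp.single a 1 := by
  rw [mono, dif_pos a.2]

lemma mono_eq_zero {a : Fin (m + n) → ℕ} {i : Fin (m + n)} (hi : m ≤ i.1) (ha : 1 < a i) :
    mono k a = 0 := by
  rw [mono, dif_neg fun h => by have := h i hi; omega]

lemma omega_ext {N : Type*} [AddCommGroup N] [Module k N] {f g : Omega k m n →ₗ[k] N}
    (h : ∀ a : Expo m n, f (mono k a.1) = g (mono k a.1)) : f = g :=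
  Finsupp.lhom_ext' fun a => LinearMap.ext_ring <| by
    simpa [mono_of_valid] using h a

/-- The operator `x^a ↦ f(aᵢ) x^{a'}`, where `a'` arises from `a` by changing `aᵢ` to `g(aᵢ)`. -/
def siteOp (i : Fin (m + n)) (f : ℕ → k) (g : ℕ → ℕ) : Module.End k (Omega k m n) :=
  Finsupp.linearCombination k fun a : Expo m n =>
    f (a.1 i) • mono k (Function.update a.1 i (g (a.1 i)))

lemma siteOp_mono {i : Fin (m + n)} {f : ℕ → k} {g : ℕ → ℕ}
    (h : m ≤ i.1 → ∀ x, 1 < x → f x = 0 ∨ 1 < g x) (a : Fin (m + n) → ℕ) :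
    siteOp i f g (mono k a) = f (a i) • mono k (Function.update a i (g (a i))) := by
  by_cases ha : ∀ j : Fin (m + n), m ≤ j.1 → a j ≤ 1
  · have := mono_of_valid (k := k) ⟨a, ha⟩
    rw [this, siteOp, Finsupp.linearCombination_single, one_smul]
  · push Not at ha
    obtain ⟨j, hj, hja⟩ := ha
    rw [mono_eq_zero hj hja, map_zero]
    by_cases hij : j = i
    · subst hij
      rcases h hj _ hja with h0 | h0
      · rw [h0, zero_smul]
      · rw [mono_eq_zero hj (by simpa using h0), smul_zero]
    · rw [mono_eq_zero (i := j) hj (by simpa [hij] using hja), smul_zero]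

/-- The coefficient of the raising operator at the site `i`, in terms of the new exponent: `[x]` at
an even site; at an odd site it is `1` if the new exponent is `1`, and `0` otherwise. -/
def raiseCoeff (q : k) (i : Fin (m + n)) (x : ℕ) : k :=
  if i.1 < m then qInt q x else if x = 1 then 1 else 0

/-- The coefficient of the lowering operator at the site `i`, in terms of the old exponent. -/
def lowerCoeff (k : Type*) [Field k] (i : Fin (m + n)) (x : ℕ) : k :=
  if x = 0 ∨ (m ≤ i.1 ∧ 1 < x) then 0 else 1

/-- The untwisted multiplication by `x_i`: it raises the `i`-th exponent by one. Unlike the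
operators `opX`, these operators at different sites commute. -/
def raise (q : k) (i : Fin (m + n)) : Module.End k (Omega k m n) :=
  siteOp i (fun x => raiseCoeff q i (x + 1)) (fun x => x + 1)

/-- The untwisted derivative by `x_i`: it lowers the `i`-th exponent by one. -/
def lower (k : Type*) [Field k] (i : Fin (m + n)) : Module.End k (Omega k m n) :=
  siteOp i (lowerCoeff k i) (fun x => x - 1)

lemma raise_mono (q : k) (i : Fin (m + n)) (a : Fin (m + n) → ℕ) :
    raise q i (mono k a) = raiseCoeff q i (a i + 1) • mono k (Function.update a i (a i + 1)) :=
  siteOp_mono (fun _ x hx => Or.inr (by omega)) a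

lemma lower_mono (i : Fin (m + n)) (a : Fin (m + n) → ℕ) :
    lower k i (mono k a) = lowerCoeff k i (a i) • mono k (Function.update a i (a i - 1)) :=
  siteOp_mono (fun h x hx => Or.inl (by simp [lowerCoeff, h, hx])) a

lemma raise_commute_raise (q : k) (i j : Fin (m + n)) : Commute (raise q i) (raise q j) := by
  by_cases h : i = j
  · subst h; exact Commute.refl _
  · refine omega_ext fun a => ?_
    simp [raise_mono, smul_smul, mul_comm, Function.update_comm h, Ne.symm h, h]

lemma lower_commute_lower (i j : Fin (m + n)) : Commute (lower k i) (lower k j) := by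
  by_cases h : i = j
  · subst h; exact Commute.refl _
  · refine omega_ext fun a => ?_
    simp [lower_mono, smul_smul, mul_comm, Function.update_comm h, Ne.symm h, h]

lemma raise_commute_lower (q : k) {i j : Fin (m + n)} (h : i ≠ j) :
    Commute (raise q i) (lower k j) := by
  refine omega_ext fun a => ?_
  simp [raise_mono, lower_mono, smul_smul, mul_comm, Function.update_comm h, Ne.symm h, h]

lemma raise_mul_lower_mono (q : k) (i : Fin (m + n)) (a : Expo m n) :
    (raise q i * lower k i) (mono k a.1) = raiseCoeff q i (a.1 i) • mono k a.1 := by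
  rw [Module.End.mul_apply, lower_mono, map_smul, raise_mono]
  have h1 := a.2 i
  rcases Nat.eq_zero_or_pos (a.1 i) with h | h
  · simp [h, lowerCoeff, raiseCoeff]
  · have h2 : ¬ (a.1 i = 0 ∨ m ≤ i.1 ∧ 1 < a.1 i) := by omega
    simp [lowerCoeff, h2, Nat.sub_add_cancel h]

/-- The eigenvalue of `lower i * raise i` on a monomial. -/
def lowerRaiseCoeff (q : k) (i : Fin (m + n)) (x : ℕ) : k :=
  if i.1 < m then qInt q (x + 1) else if x = 0 then 1 else 0

lemma lower_mul_raise_mono (q : k) (i : Fin (m + n)) (a : Expo m n) :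
    (lower k i * raise q i) (mono k a.1) = lowerRaiseCoeff q i (a.1 i) • mono k a.1 := by
  rw [Module.End.mul_apply, raise_mono, map_smul, lower_mono]
  by_cases hi : i.1 < m
  · simp [lowerCoeff, raiseCoeff, lowerRaiseCoeff, hi, not_le.2 hi]
  · by_cases h : a.1 i = 0 <;> simp [lowerCoeff, raiseCoeff, lowerRaiseCoeff, hi, h]
    rw [← h, Function.update_eq_self]

lemma raise_mul_raise_of_odd (q : k) {i : Fin (m + n)} (hi : m ≤ i.1) :
    raise q i * raise q i = 0 := by
  refine omega_ext fun a => ?_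
  have h : ∀ x, raiseCoeff q i (x + 1) * raiseCoeff q i (x + 1 + 1) = 0 := by
    simp [raiseCoeff, not_lt.2 hi]
  simp [raise_mono, smul_smul, h]

lemma lower_mul_lower_of_odd {i : Fin (m + n)} (hi : m ≤ i.1) :
    lower k i * lower k i = 0 := by
  refine omega_ext fun a => ?_
  have h : ∀ x, lowerCoeff k i x * lowerCoeff k i (x - 1) = 0 := by
    intro x
    rw [lowerCoeff, lowerCoeff]
    split_ifs <;> first | (simp; done) | omega
  simp [lower_mono, smul_smul, h]

lemma raise_raise_lower {q : k} (hq0 : q ≠ 0) {i : Fin (m + n)} (hi : i.1 < m) :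
    raise q i * raise q i * lower k i + lower k i * raise q i * raise q i =
      (q + q⁻¹) • (raise q i * lower k i * raise q i) := by
  refine omega_ext fun a => ?_
  have key := qInt_add_qInt hq0 (a.1 i)
  have h1 := raise_mul_lower_mono q i a
  have h2 := lower_mul_raise_mono q i a
  rw [LinearMap.smul_apply, LinearMap.add_apply, mul_assoc, Module.End.mul_apply, h1,
    mul_assoc (raise q i), Module.End.mul_apply (raise q i) (lower k i * raise q i), h2]
  simp only [Module.End.mul_apply, map_smul, raise_mono, lower_mono, Function.update_self,
    Function.update_idem, raiseCoeff, lowerCoeff, lowerRaiseCoeff, if_pos hi, not_le.2 hi,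
    smul_smul, false_and, or_false]
  simp only [Nat.add_eq_zero_iff, one_ne_zero, and_false, if_false, mul_one, Nat.add_sub_cancel]
  rw [← add_smul]
  congr 1
  linear_combination qInt q (a.1 i + 1) * key

lemma lower_lower_raise {q : k} (hq0 : q ≠ 0) {i : Fin (m + n)} (hi : i.1 < m) :
    lower k i * lower k i * raise q i + raise q i * lower k i * lower k i =
      (q + q⁻¹) • (lower k i * raise q i * lower k i) := by
  refine omega_ext fun a => ?_
  have h1 := raise_mul_lower_mono q i a
  have h2 := lower_mul_raise_mono q i a
  rw [LinearMap.smul_apply, LinearMap.add_apply, mul_assoc, Module.End.mul_apply, h2,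
    mul_assoc (lower k i), Module.End.mul_apply (lower k i) (raise q i * lower k i), h1]
  rcases h : a.1 i with _ | x
  · simp [lower_mono, h, lowerCoeff]
  · have key := qInt_add_qInt hq0 x
    simp only [Module.End.mul_apply, map_smul, raise_mono, lower_mono, Function.update_self,
      Function.update_idem, raiseCoeff, lowerCoeff, lowerRaiseCoeff, if_pos hi, not_le.2 hi,
      smul_smul, false_and, or_false, h]
    rcases x with _ | x
    · simp at key
      simp [key]
    · simp only [Nat.add_eq_zero_iff, one_ne_zero, and_false, if_false, mul_one, one_mul,
        Nat.add_sub_cancel]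
      rw [← add_smul]
      congr 1
      linear_combination key

lemma raise_pow_mono {q : k} {i : Fin (m + n)} (r : ℕ) (a : Fin (m + n) → ℕ) :
    (raise q i ^ r) (mono k a) =
      (∏ s ∈ Finset.range r, raiseCoeff q i (a i + s + 1)) •
        mono k (Function.update a i (a i + r)) := by
  induction r with
  | zero => simp
  | succ r ih =>
    rw [pow_succ', Module.End.mul_apply, ih, map_smul, raise_mono, smul_smul,
      Finset.prod_range_succ]
    simp [add_assoc]

lemma raise_pow_eq_zero {q : k} (hq0 : q ≠ 0) (hq : q - q⁻¹ ≠ 0) (i : Fin (m + n)) {l : ℕ}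
    (hl : qInt q l = 0) (hl2 : 2 ≤ l) : raise q i ^ l = 0 := by
  by_cases hi : i.1 < m
  · refine omega_ext fun a => ?_
    rw [raise_pow_mono, LinearMap.zero_apply]
    -- one of the `l` consecutive numbers `aᵢ + 1, …, aᵢ + l` is a multiple of `l`
    have hlt : a.1 i % l < l := Nat.mod_lt _ (by omega)
    rw [Finset.prod_eq_zero (i := l - 1 - a.1 i % l) (Finset.mem_range.2 (by omega)), zero_smul]
    have hdm := Nat.div_add_mod (a.1 i) l
    have e : a.1 i + (l - 1 - a.1 i % l) + 1 = l * (a.1 i / l + 1) := by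
      rw [mul_add, mul_one]; omega
    rw [raiseCoeff, if_pos hi, e, qInt_mul_eq_zero hq0 hq hl]
  · obtain ⟨r, rfl⟩ := Nat.exists_eq_add_of_le hl2
    rw [pow_add, pow_two, raise_mul_raise_of_odd q (not_lt.1 hi), zero_mul]

end SiteOperators

/-! ### The operators without twists -/

section Untwisting

variable {k : Type*} [Field k] {q : k} {m n : ℕ}

lemma diag_mono (c : Expo m n → k) (a : Expo m n) : diag c (mono k a.1) = c a • mono k a.1 := by
  rw [mono_of_valid, diag, Finsupp.linearCombination_single, one_smul, Finsupp.smul_single,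
    smul_eq_mul, mul_one]

lemma starProd_single (i : Fin (m + n)) (b : Fin (m + n) → ℕ) :
    starProd (Pi.single i 1) b = ∑ j, if j < i then b j else 0 := by
  rw [starProd, Finset.sum_eq_single i]
  · simp
  · intro x _ hx
    simp [hx]
  · simp

lemma oddStarProd_single (i : Fin (m + n)) (b : Fin (m + n) → ℕ) :
    oddStarProd (Pi.single i 1) b = ∑ j, if j < i ∧ m ≤ j.1 then b j else 0 := by
  rw [oddStarProd, Finset.sum_eq_single i]
  · simp
  · intro x _ hx
    simp [hx]
  · simp

/-- The factor `q^(ε_i*b) (-1)^(ε_i*b)` by which `x_i` differs from `raise i`, and `∂_i⁻¹` from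
`lower i`. -/
def twist (q : k) (i : Fin (m + n)) (b : Fin (m + n) → ℕ) : k :=
  q ^ starProd (Pi.single i 1) b * (-1) ^ oddStarProd (Pi.single i 1) b

lemma twist_ne_zero (hq0 : q ≠ 0) (i : Fin (m + n)) (b : Fin (m + n) → ℕ) : twist q i b ≠ 0 :=
  mul_ne_zero (pow_ne_zero _ hq0) (pow_ne_zero _ (by simp))

lemma lo_lt_hi (j : Fin (m + n - 1)) : lo j < hi j := by simp [lo, hi, Fin.lt_def]

lemma lo_ne_hi (j : Fin (m + n - 1)) : lo j ≠ hi j := (lo_lt_hi j).ne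

lemma twist_hi (j : Fin (m + n - 1)) (b : Fin (m + n) → ℕ) :
    twist q (hi j) b = twist q (lo j) b * (if (lo j).1 < m then q else -q) ^ b (lo j) := by
  have h1 : starProd (Pi.single (hi j) 1) b = starProd (Pi.single (lo j) 1) b + b (lo j) := by
    have e : b (lo j) = ∑ x, if x = lo j then b x else 0 := by
      rw [Finset.sum_ite_eq' Finset.univ (lo j), if_pos (Finset.mem_univ _)]
    rw [starProd_single, starProd_single, e, ← Finset.sum_add_distrib]
    refine Finset.sum_congr rfl fun x _ => ?_
    simp only [lo, hi, Fin.lt_def, Fin.ext_iff]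
    split_ifs <;> omega
  have h2 : oddStarProd (Pi.single (hi j) 1) b =
      oddStarProd (Pi.single (lo j) 1) b + if m ≤ (lo j).1 then b (lo j) else 0 := by
    have e : (if m ≤ (lo j).1 then b (lo j) else 0) =
        ∑ x, if x = lo j then (if m ≤ x.1 then b x else 0) else 0 := by
      rw [Finset.sum_ite_eq' Finset.univ (lo j), if_pos (Finset.mem_univ _)]
    rw [oddStarProd_single, oddStarProd_single, e, ← Finset.sum_add_distrib]
    refine Finset.sum_congr rfl fun x _ => ?_
    simp only [lo, hi, Fin.lt_def, Fin.ext_iff]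
    split_ifs <;> omega
  rw [twist, h1, h2, twist]
  by_cases h : (lo j).1 < m
  · simp only [h, not_le.2 h, if_true, if_false, add_zero, pow_add]
    ring
  · simp only [h, not_lt.1 h, if_true, if_false, pow_add, neg_pow q]
    ring

lemma twist_lo_update (j : Fin (m + n - 1)) (b : Fin (m + n) → ℕ) (i : Fin (m + n)) (x : ℕ)
    (h : lo j ≤ i) : twist q (lo j) (Function.update b i x) = twist q (lo j) b := by
  have h' : ∀ y, y < lo j → Function.update b i x y = b y := fun y hy =>
    Function.update_of_ne (lt_of_lt_of_le hy h).ne _ _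
  rw [twist, twist, starProd_single, starProd_single, oddStarProd_single, oddStarProd_single]
  congr 2
  · refine Finset.sum_congr rfl fun y _ => ?_
    by_cases hy : y < lo j <;> simp [hy, h' y]
  · refine Finset.sum_congr rfl fun y _ => ?_
    by_cases hy : y < lo j <;> simp [hy, h' y]

lemma mono_single_valid (i : Fin (m + n)) :
    ∀ j : Fin (m + n), m ≤ j.1 → (Pi.single i 1 : Fin (m + n) → ℕ) j ≤ 1 := by
  intro j _
  rw [Pi.single_apply]
  split_ifs <;> simp

lemma opX_mono (hq0 : q ≠ 0) (hq : q - q⁻¹ ≠ 0) (i : Fin (m + n)) (b : Expo m n) :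
    opX q i (mono k b.1) = twist q i b.1 • raise q i (mono k b.1) := by
  have e : (Pi.single i 1 : Fin (m + n) → ℕ) + b.1 = Function.update b.1 i (b.1 i + 1) := by
    funext x
    by_cases h : x = i
    · subst h; simp [add_comm]
    · simp [h]
  have e2 : (∏ x : Fin (m + n), if x.1 < m then
      qBinom q ((Pi.single i 1 : Fin (m + n) → ℕ) x + b.1 x)
        ((Pi.single i 1 : Fin (m + n) → ℕ) x) else 1) =
      if i.1 < m then qInt q (b.1 i + 1) else 1 := by
    rw [Finset.prod_eq_single i]
    · simp [qBinom_one_right hq0 hq, add_comm]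
    · intro x _ hx
      simp [hx, qBinom_zero_right]
    · simp
  have h1 : mono k (Pi.single i 1) = Finsupp.single (⟨_, mono_single_valid i⟩ : Expo m n) (1 : k) :=
    mono_of_valid ⟨_, mono_single_valid i⟩
  rw [opX, mulΩ, h1, mono_of_valid b, Finsupp.linearCombination_single, one_smul,
    Finsupp.linearCombination_single, one_smul, ← mono_of_valid b, raise_mono, smul_smul,
    mulCoeff, e2, e, twist, raiseCoeff]
  by_cases h : i.1 < m
  · simp [h]
  · by_cases hb : b.1 i = 0
    · simp [h, hb]
    · rw [mono_eq_zero (i := i) (not_lt.1 h) (by simp; omega), smul_zero, smul_zero]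

lemma opD_mono (i : Fin (m + n)) (b : Expo m n) :
    opD q i (mono k b.1) = (twist q i b.1)⁻¹ • lower k i (mono k b.1) := by
  have e : b.1 - (Pi.single i 1 : Fin (m + n) → ℕ) = Function.update b.1 i (b.1 i - 1) := by
    funext x
    by_cases h : x = i
    · subst h; simp
    · simp [h]
  have h1 := b.2 i
  rw [lower_mono, mono_of_valid b, opD, Finsupp.linearCombination_single, one_smul, e,
    lowerCoeff, twist]
  by_cases h : b.1 i = 0
  · simp [h]
  · have h2 : ¬ (b.1 i = 0 ∨ m ≤ i.1 ∧ 1 < b.1 i) := by omega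
    rw [if_neg h, if_neg h2, one_smul]

/-- The exponents obtained from `b` by moving one unit from the place `j` to the place `i`. -/
def move (b : Fin (m + n) → ℕ) (i j : Fin (m + n)) : Fin (m + n) → ℕ :=
  Function.update (Function.update b j (b j - 1)) i (b i + 1)

lemma raise_mul_lower_mono_of_ne {i j : Fin (m + n)} (hij : i ≠ j) (b : Fin (m + n) → ℕ) :
    (raise q i * lower k j) (mono k b) =
      (lowerCoeff k j (b j) * raiseCoeff q i (b i + 1)) • mono k (move b i j) := by
  rw [Module.End.mul_apply, lower_mono, map_smul, raise_mono, smul_smul, move,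
    Function.update_of_ne hij]

lemma valid_lower (b : Expo m n) (i : Fin (m + n)) :
    ∀ j : Fin (m + n), m ≤ j.1 → Function.update b.1 i (b.1 i - 1) j ≤ 1 := by
  intro j hj
  have := b.2 j hj
  by_cases h : j = i
  · subst h; simp; omega
  · simpa [h] using this

theorem opE_eq (hq0 : q ≠ 0) (hq : q - q⁻¹ ≠ 0) (j : Fin (m + n - 1)) :
    opE q j = raise q (lo j) * lower k (hi j) := by
  refine omega_ext fun b => ?_
  have hX := opX_mono hq0 hq (lo j) ⟨_, valid_lower b (hi j)⟩
  have ht := twist_lo_update (q := q) j b.1 (hi j) (b.1 (hi j) - 1) (lo_lt_hi j).le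
  have hs := twist_hi (q := q) j b.1
  have h0 := twist_ne_zero hq0 (lo j) b.1
  have h1 := twist_ne_zero hq0 (hi j) b.1
  simp only at hX
  rw [opE, LinearMap.comp_apply, LinearMap.comp_apply, opSigma, diag_mono, map_smul, map_smul,
    opD_mono, map_smul, lower_mono, map_smul, hX, ht, Module.End.mul_apply, lower_mono, map_smul,
    smul_smul, smul_smul, smul_smul]
  congr 1
  rw [hs] at h1 ⊢
  have h2 := right_ne_zero_of_mul h1
  field_simp

theorem opF_eq (hq0 : q ≠ 0) (hq : q - q⁻¹ ≠ 0) (j : Fin (m + n - 1)) :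
    opF q j = raise q (hi j) * lower k (lo j) := by
  refine omega_ext fun b => ?_
  have hX := opX_mono hq0 hq (hi j) ⟨_, valid_lower b (lo j)⟩
  have hs := twist_hi (q := q) j (Function.update b.1 (lo j) (b.1 (lo j) - 1))
  rw [twist_lo_update (q := q) j b.1 (lo j) (b.1 (lo j) - 1) le_rfl] at hs
  have h0 := twist_ne_zero hq0 (lo j) b.1
  have h1 := twist_ne_zero hq0 (hi j) (Function.update b.1 (lo j) (b.1 (lo j) - 1))
  simp only at hX
  rw [opF, LinearMap.comp_apply, LinearMap.comp_apply, opD_mono, map_smul, lower_mono, map_smul,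
    map_smul, hX, raise_mul_lower_mono_of_ne (lo_ne_hi j).symm, raise_mono, map_smul, map_smul,
    Function.update_of_ne (lo_ne_hi j).symm, ← move]
  by_cases hv : ∀ x : Fin (m + n), m ≤ x.1 → move b.1 (hi j) (lo j) x ≤ 1
  · have hD := diag_mono (fun a : Expo m n =>
      ((if (lo j).1 < m then q else -q) ^ a.1 (lo j))⁻¹) ⟨_, hv⟩
    simp only at hD
    rw [opSigmaInv, map_smul, hD, smul_smul, smul_smul, smul_smul, smul_smul]
    congr 1
    rw [hs] at h1 ⊢
    have h2 := right_ne_zero_of_mul h1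
    rw [move, Function.update_of_ne (lo_ne_hi j)]
    field_simp
  · rw [mono, dif_neg hv]
    simp

/-- The exponents of a monomial as a weight. -/
def expoWeight (b : Fin (m + n) → ℕ) : Weight m n := fun i => (b i : ℤ)

/-- The torus element attached to the weight `β`: it multiplies `x^b` by `q^(β, b)`. -/
def torusOp (q : k) (β : Weight m n) : Module.End k (Omega k m n) :=
  diag fun a => q ^ form β (expoWeight a.1)

lemma form_add_left (a b c : Weight m n) : form (a + b) c = form a c + form b c := by
  simp only [form, ← Finset.sum_add_distrib, Pi.add_apply]
  exact Finset.sum_congr rfl fun i _ => by ring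

lemma form_add_right (a b c : Weight m n) : form a (b + c) = form a b + form a c := by
  simp only [form, ← Finset.sum_add_distrib, Pi.add_apply]
  exact Finset.sum_congr rfl fun i _ => by ring

lemma form_neg_left (a b : Weight m n) : form (-a) b = -form a b := by
  simp [form]

lemma form_neg_right (a b : Weight m n) : form a (-b) = -form a b := by
  simp [form]

lemma form_zero_left (b : Weight m n) : form 0 b = 0 := by simp [form]

lemma form_single_left (i : Fin (m + n)) (b : Weight m n) :
    form (Pi.single i 1) b = (if i.1 < m then 1 else -1) * b i := by
  rw [form, Finset.sum_eq_single i]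
  · simp
  · intro x _ hx
    simp [hx]
  · simp

lemma torusOp_mono (β : Weight m n) (b : Expo m n) :
    torusOp q β (mono k b.1) = q ^ form β (expoWeight b.1) • mono k b.1 := diag_mono _ b

lemma torusOp_add (hq0 : q ≠ 0) (β γ : Weight m n) :
    torusOp q (β + γ) = torusOp q β * torusOp q γ := by
  refine omega_ext fun b => ?_
  rw [Module.End.mul_apply, torusOp_mono, torusOp_mono, map_smul, torusOp_mono, smul_smul,
    form_add_left, zpow_add₀ hq0, mul_comm]

lemma torusOp_zero : torusOp q (0 : Weight m n) = 1 := by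
  refine omega_ext fun b => ?_
  rw [torusOp_mono, form_zero_left, zpow_zero, one_smul, Module.End.one_apply]

lemma opSigma_mono (i : Fin (m + n)) (b : Expo m n) : opSigma q i (mono k b.1) =
    (if i.1 < m then q else -q) ^ b.1 i • mono k b.1 := diag_mono _ b

lemma opSigmaInv_mono (i : Fin (m + n)) (b : Expo m n) : opSigmaInv q i (mono k b.1) =
    ((if i.1 < m then q else -q) ^ b.1 i)⁻¹ • mono k b.1 := diag_mono _ b

lemma opTau_mono (i : Fin (m + n)) (b : Expo m n) : opTau i (mono k b.1) =
    (-1 : k) ^ b.1 i • mono k b.1 := diag_mono _ b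

lemma opParity_mono (b : Expo m n) : opParity (mono k b.1) =
    (-1 : k) ^ (∑ i, if m ≤ i.1 then b.1 i else 0) • mono k b.1 := diag_mono _ b

lemma opK_eq (i : Fin (m + n)) : opK q i = torusOp q (Pi.single i 1) := by
  refine omega_ext fun b => ?_
  rw [torusOp_mono, form_single_left, opK]
  by_cases h : i.1 < m
  · simp [h, opSigma_mono, expoWeight]
  · simp only [h, if_false, LinearMap.comp_apply, opSigmaInv_mono, map_smul, opTau_mono, smul_smul,
      expoWeight]
    congr 1
    rw [neg_pow q, neg_one_mul, zpow_neg, zpow_natCast, mul_inv, ← inv_pow (-1 : k), inv_neg_one,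
      mul_right_comm, ← mul_pow]
    simp

lemma opKinv_eq (i : Fin (m + n)) : opKinv q i = torusOp q (-Pi.single i 1) := by
  refine omega_ext fun b => ?_
  rw [torusOp_mono, form_neg_left, form_single_left, opKinv]
  by_cases h : i.1 < m
  · simp [h, opSigmaInv_mono, expoWeight]
  · simp only [h, if_false, LinearMap.comp_apply, opSigma_mono, map_smul, opTau_mono, smul_smul,
      expoWeight]
    congr 1
    rw [neg_pow q, neg_one_mul, neg_neg, zpow_natCast, ← mul_assoc, ← mul_pow]
    simp

theorem opT_eq (hq0 : q ≠ 0) (g : LieType) (a : g.Torus m n) :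
    opT q g a = torusOp q (torusWeight g a) := by
  cases g with
  | gl => exact opK_eq _
  | sl =>
    change opK q (lo _) ∘ₗ opKinv q (hi _) = torusOp q (simpleRoot _)
    rw [opK_eq, opKinv_eq, simpleRoot, sub_eq_add_neg, torusOp_add hq0]
    rfl

/-- Moving one unit from `j` to `i` changes the weight by `ε_i - ε_j`. -/
lemma expoWeight_move {b : Fin (m + n) → ℕ} {i j : Fin (m + n)} (hij : i ≠ j) (hj : b j ≠ 0) :
    expoWeight (move b i j) = expoWeight b + (Pi.single i 1 - Pi.single j 1) := by
  funext x
  by_cases hi : x = i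
  · subst hi
    simp [expoWeight, move, hij]
  · by_cases hx : x = j
    · subst hx
      simp [expoWeight, move, hi]
      omega
    · simp [expoWeight, move, hi, hx]

/-- The operator `raise i * lower j` maps a monomial to zero or to a multiple of a monomial whose
weight is larger by `ε_i - ε_j`. -/
lemma raise_mul_lower_mono_cases (q : k) {i j : Fin (m + n)} (hij : i ≠ j) (b : Expo m n) :
    (raise q i * lower k j) (mono k b.1) = 0 ∨ ∃ (c : k) (b' : Expo m n),
      (raise q i * lower k j) (mono k b.1) = c • mono k b'.1 ∧
      expoWeight b'.1 = expoWeight b.1 + (Pi.single i 1 - Pi.single j 1) := by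
  rw [raise_mul_lower_mono_of_ne hij]
  by_cases hj : b.1 j = 0
  · left
    simp [lowerCoeff, hj]
  · by_cases hv : ∀ x : Fin (m + n), m ≤ x.1 → move b.1 i j x ≤ 1
    · exact Or.inr ⟨_, ⟨_, hv⟩, rfl, expoWeight_move hij hj⟩
    · left
      rw [mono, dif_neg hv, smul_zero]

lemma torusOp_mul_raise_lower (hq0 : q ≠ 0) (β : Weight m n) {i j : Fin (m + n)} (hij : i ≠ j) :
    torusOp q β * (raise q i * lower k j) =
      q ^ form β (Pi.single i 1 - Pi.single j 1) • ((raise q i * lower k j) * torusOp q β) := by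
  refine omega_ext fun b => ?_
  rw [Module.End.mul_apply, LinearMap.smul_apply, Module.End.mul_apply (raise q i * lower k j),
    torusOp_mono, map_smul]
  rcases raise_mul_lower_mono_cases q hij b with h | ⟨c, b', h, hb⟩
  · simp [h]
  · rw [h, map_smul, torusOp_mono, hb, form_add_right, zpow_add₀ hq0]
    simp only [smul_smul]
    congr 1
    ring

lemma neg_one_pow_eq_zpow_oddDegree (b : Fin (m + n) → ℕ) :
    (-1 : k) ^ (∑ i : Fin (m + n), if m ≤ i.1 then b i else 0) =
      (-1 : k) ^ oddDegree (expoWeight b) := by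
  rw [← zpow_natCast]
  congr 1
  simp [oddDegree, expoWeight]

lemma oddDegree_add (a b : Weight m n) : oddDegree (a + b) = oddDegree a + oddDegree b := by
  rw [oddDegree, oddDegree, oddDegree, ← Finset.sum_add_distrib]
  refine Finset.sum_congr rfl fun i _ => ?_
  split_ifs <;> simp

lemma oddDegree_neg (a : Weight m n) : oddDegree (-a) = -oddDegree a := by
  rw [oddDegree, oddDegree, ← Finset.sum_neg_distrib]
  refine Finset.sum_congr rfl fun i _ => ?_
  split_ifs <;> simp

lemma oddDegree_single (i : Fin (m + n)) :
    oddDegree (Pi.single i 1 : Weight m n) = if m ≤ i.1 then 1 else 0 := by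
  rw [oddDegree, Finset.sum_eq_single i]
  · simp
  · intro x _ hx
    simp [hx]
  · simp

lemma neg_one_zpow_oddDegree_simpleRoot (j : Fin (m + n - 1)) :
    (-1 : k) ^ oddDegree (simpleRoot j) = (-1) ^ par j := by
  rw [simpleRoot, sub_eq_add_neg, oddDegree_add, oddDegree_neg, oddDegree_single, oddDegree_single,
    par]
  have h1 : (lo j).1 = j.1 := rfl
  have h2 : (hi j).1 = j.1 + 1 := rfl
  simp only [h1, h2]
  by_cases h : IsOdd j
  · have h' : j.1 + 1 = m := h
    rw [if_neg (by omega), if_pos (by omega), if_pos h]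
    simp
  · have h' : ¬ j.1 + 1 = m := h
    rw [if_neg h]
    split_ifs <;> first | omega | simp

lemma opParity_mul_opParity : opParity * opParity = (1 : Module.End k (Omega k m n)) := by
  refine omega_ext fun b => ?_
  rw [Module.End.mul_apply, opParity_mono, map_smul, opParity_mono, smul_smul, ← mul_pow]
  simp

lemma opParity_mul_raise_lower (q : k) {i j : Fin (m + n)} (hij : i ≠ j) :
    opParity * (raise q i * lower k j) * opParity =
      (-1 : k) ^ oddDegree (Pi.single i 1 - Pi.single j 1 : Weight m n) •
        (raise q i * lower k j) := by
  refine omega_ext fun b => ?_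
  rw [Module.End.mul_apply, opParity_mono, map_smul, LinearMap.smul_apply, Module.End.mul_apply]
  rcases raise_mul_lower_mono_cases q hij b with h | ⟨c, b', h, hb⟩
  · simp [h]
  · have h1 : (-1 : k) ^ oddDegree (expoWeight b.1) * (-1) ^ oddDegree (expoWeight b.1) = 1 := by
      rw [← mul_zpow]; simp
    rw [h, map_smul, opParity_mono, neg_one_pow_eq_zpow_oddDegree, neg_one_pow_eq_zpow_oddDegree,
      hb, oddDegree_add, zpow_add₀ (by simp)]
    simp only [smul_smul]
    congr 1
    linear_combination c * (-1 : k) ^ oddDegree (Pi.single i 1 - Pi.single j 1 : Weight m n) * h1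

end Untwisting

/-! ### Serre relations from commuting sites -/

section SerreRelations

variable {k A : Type*} [Field k] [Ring A] [Algebra k A]

/-- The quantum Serre relation for the products `u p` and `r v`, where `u` and `v` commute with
everything, reduces to a relation between `p` and `r`, operators at the same site. -/
lemma serre_of_commute {u p r v : A} {c : k} (hup : Commute u p) (hur : Commute u r)
    (huv : Commute u v) (hvp : Commute v p) (hvr : Commute v r)
    (h : p * p * r + r * p * p = c • (p * r * p) ∨ u * u = 0) :
    (u * p) * (u * p) * (r * v) - c • ((u * p) * (r * v) * (u * p))
      + (r * v) * (u * p) * (u * p) = 0 := by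
  have e1 : (u * p) * (u * p) * (r * v) = (u * u) * v * (p * p * r) := by
    simp only [mul_assoc, hup.symm.left_comm, hvr.symm.eq, hvp.symm.left_comm]
  have e2 : (u * p) * (r * v) * (u * p) = (u * u) * v * (p * r * p) := by
    simp only [mul_assoc, hup.symm.left_comm, hvr.symm.left_comm, hvp.symm.left_comm,
      hur.symm.left_comm, huv.symm.left_comm]
  have e3 : (r * v) * (u * p) * (u * p) = (u * u) * v * (r * p * p) := by
    simp only [mul_assoc, hup.symm.left_comm, hvr.symm.left_comm, hur.symm.left_comm,
      huv.symm.left_comm]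
  rw [e1, e2, e3]
  rcases h with h | h
  · have h' : (u * u) * v * (p * p * r + r * p * p) = c • ((u * u) * v * (p * r * p)) := by
      rw [h, mul_smul_comm]
    rw [← h', mul_add]
    abel
  · simp [h]

/-- The higher Serre relation for `u p`, `r s` and `t v`, where `u` and `v` commute with everything,
`p` and `r` are operators at one site, and `s` and `t` at another, fermionic one. -/
lemma super_serre_of_commute {u p r s t v : A} {c : k} (huv : Commute u v)
    (hur : Commute u r) (hus : Commute u s) (hut : Commute u t)
    (hvp : Commute v p) (hvr : Commute v r) (hvs : Commute v s) (hvt : Commute v t)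
    (hps : Commute p s) (hpt : Commute p t) (hrs : Commute r s) (hrt : Commute r t)
    (hss : s * s = 0) (h : p * r * r + r * r * p = c • (r * p * r)) :
    (u * p) * (r * s) * (t * v) * (r * s) + (r * s) * (u * p) * (r * s) * (t * v)
      + (t * v) * (r * s) * (u * p) * (r * s) + (r * s) * (t * v) * (r * s) * (u * p)
      - c • ((r * s) * (u * p) * (t * v) * (r * s)) = 0 := by
  have hss' : ∀ z, s * (s * z) = 0 := fun z => by rw [← mul_assoc, hss, zero_mul]
  have e1 : (u * p) * (r * s) * (t * v) * (r * s) = u * v * (p * r * r) * (s * t * s) := by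
    simp only [mul_assoc, hvr.symm.left_comm, hvp.symm.left_comm, hvs.symm.left_comm,
      hvt.symm.left_comm, hrs.symm.left_comm, hrt.symm.left_comm]
  have e2 : (r * s) * (u * p) * (r * s) * (t * v) = 0 := by
    simp only [mul_assoc, hus.symm.left_comm, hur.symm.left_comm, hps.symm.left_comm,
      hrs.symm.left_comm, hss', mul_zero]
  have e3 : (t * v) * (r * s) * (u * p) * (r * s) = 0 := by
    simp only [mul_assoc, hus.symm.left_comm, hur.symm.left_comm, hps.symm.left_comm,
      hrs.symm.left_comm, hss, mul_zero]
  have e4 : (r * s) * (t * v) * (r * s) * (u * p) = u * v * (r * r * p) * (s * t * s) := by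
    simp only [mul_assoc, hus.symm.left_comm, hur.symm.left_comm, hut.symm.left_comm,
      huv.symm.left_comm, hvr.symm.left_comm, hvs.symm.left_comm, hvt.symm.left_comm,
      hps.symm.left_comm, hpt.symm.left_comm, hrs.symm.left_comm, hrt.symm.left_comm, hps.symm.eq]
  have e5 : (r * s) * (u * p) * (t * v) * (r * s) = u * v * (r * p * r) * (s * t * s) := by
    simp only [mul_assoc, hus.symm.left_comm, hur.symm.left_comm, hvr.symm.left_comm,
      hvp.symm.left_comm, hvs.symm.left_comm, hvt.symm.left_comm, hps.symm.left_comm,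
      hrs.symm.left_comm, hrt.symm.left_comm]
  have h' : u * v * (p * r * r + r * r * p) * (s * t * s) =
      c • (u * v * (r * p * r) * (s * t * s)) := by
    rw [h, mul_smul_comm, smul_mul_assoc]
  rw [e1, e2, e3, e4, e5, ← h', mul_add, add_mul]
  abel

end SerreRelations

/-! ### The representation on the quantum Grassmann superalgebra -/

section Representation

variable {k : Type*} [Field k] {q : k} {m n : ℕ}

lemma raise_lower_mul_raise_lower_mono {i j : Fin (m + n)} (hij : i ≠ j) (b : Expo m n) :
    ((raise q i * lower k j) * (raise q j * lower k i)) (mono k b.1) =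
      (raiseCoeff q i (b.1 i) * lowerRaiseCoeff q j (b.1 j)) • mono k b.1 := by
  have e : (raise q i * lower k j) * (raise q j * lower k i) =
      (raise q i * lower k i) * (lower k j * raise q j) := by
    have h1 := (raise_commute_lower q hij.symm).eq
    have h2 := (lower_commute_lower (k := k) i j).eq
    rw [mul_assoc, mul_assoc, h1, ← mul_assoc (lower k j), ← h2, mul_assoc]
  rw [e, Module.End.mul_apply, lower_mul_raise_mono, map_smul, raise_mul_lower_mono, smul_smul,
    mul_comm]

lemma form_simpleRoot_left (j : Fin (m + n - 1)) (b : Weight m n) :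
    form (simpleRoot j) b = (if (lo j).1 < m then 1 else -1) * b (lo j)
      - (if (hi j).1 < m then 1 else -1) * b (hi j) := by
  rw [simpleRoot, sub_eq_add_neg, form_add_left, form_neg_left, form_single_left,
    form_single_left, sub_eq_add_neg]

/-- The relation between `E_j` and `F_j`. Both products are diagonal; at the odd simple root the
signs turn the commutator into an anticommutator. -/
lemma raise_lower_supercommutator (hq0 : q ≠ 0) (hq : q - q⁻¹ ≠ 0) (j : Fin (m + n - 1)) :
    (raise q (lo j) * lower k (hi j)) * (raise q (hi j) * lower k (lo j))
      - (-1 : k) ^ (par j * par j) •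
        ((raise q (hi j) * lower k (lo j)) * (raise q (lo j) * lower k (hi j))) =
      (qSub q m j.1 - (qSub q m j.1)⁻¹)⁻¹ •
        (torusOp q (simpleRoot j) - torusOp q (-simpleRoot j)) := by
  refine omega_ext fun b => ?_
  have hx := b.2 (lo j)
  have hy := b.2 (hi j)
  rw [LinearMap.sub_apply, LinearMap.smul_apply, LinearMap.smul_apply, LinearMap.sub_apply,
    raise_lower_mul_raise_lower_mono (lo_ne_hi j),
    raise_lower_mul_raise_lower_mono (lo_ne_hi j).symm, torusOp_mono, torusOp_mono, ← sub_smul,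
    smul_smul, smul_smul, ← sub_smul, form_neg_left, form_simpleRoot_left, raiseCoeff, raiseCoeff,
    lowerRaiseCoeff, lowerRaiseCoeff]
  congr 1
  simp only [expoWeight]
  generalize b.1 (lo j) = x at hx ⊢
  generalize b.1 (hi j) = y at hy ⊢
  have h1 : (lo j).1 = j.1 := rfl
  have h2 : (hi j).1 = j.1 + 1 := rfl
  rw [h1] at hx ⊢
  rw [h2] at hy ⊢
  have e : ∀ z : ℕ, (q - q⁻¹)⁻¹ * (q ^ (z : ℤ) - q ^ (-(z : ℤ))) = qInt q z := fun z => by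
    rw [qInt, div_eq_mul_inv, mul_comm, zpow_neg, zpow_natCast]
  rcases lt_trichotomy (j.1 + 1) m with h | h | h
  · have h' : ¬ IsOdd j := fun h0 => by have h0' : j.1 + 1 = m := h0; omega
    have key := qInt_mul_succ_sub hq0 hq x y
    have hj : j.1 < m := by omega
    simp only [h, hj, if_true, par, h', if_false, qSub, one_mul, mul_zero, pow_zero]
    rw [neg_sub, ← key]
    ring
  · have h' : IsOdd j := h
    have hj : j.1 < m := by omega
    have hm : ¬ j.1 + 1 < m := by omega
    have hy := hy (by omega)
    have key := e (x + y)
    simp only [hj, hm, if_true, par, h', if_false, qSub, one_mul, mul_one, pow_one, neg_mul,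
      sub_neg_eq_add]
    rw [← Nat.cast_add, key]
    interval_cases y <;> simp
  · have h' : ¬ IsOdd j := fun h0 => by have h0' : j.1 + 1 = m := h0; omega
    have hj : ¬ j.1 < m := by omega
    have hm : ¬ j.1 + 1 < m := by omega
    have hx := hx (by omega)
    have hy := hy (by omega)
    have hq' : q⁻¹ - q ≠ 0 := fun h0 => hq (by linear_combination -h0)
    simp only [hj, hm, if_false, par, h', qSub, one_mul, mul_zero, pow_zero, inv_inv]
    interval_cases x <;> interval_cases y <;> simp [hq']
    rw [← neg_sub, inv_neg, neg_mul, inv_mul_cancel₀]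
    exact fun h0 => hq (by linear_combination h0)

/-- The operators by which the generators act. -/
def genOp (q : k) (g : LieType) : Gen g m n → Module.End k (Omega k m n)
  | .E j => raise q (lo j) * lower k (hi j)
  | .F j => raise q (hi j) * lower k (lo j)
  | .T a => torusOp q (torusWeight g a)
  | .Tinv a => torusOp q (-torusWeight g a)
  | .sigma => opParity

section Lift

variable (g : LieType)

@[simp] lemma lift_fE (j : Fin (m + n - 1)) : FreeAlgebra.lift k (genOp q g) (fE k g m n j) =
    raise q (lo j) * lower k (hi j) := FreeAlgebra.lift_ι_apply _ _

@[simp] lemma lift_fF (j : Fin (m + n - 1)) : FreeAlgebra.lift k (genOp q g) (fF k g m n j) =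
    raise q (hi j) * lower k (lo j) := FreeAlgebra.lift_ι_apply _ _

@[simp] lemma lift_fT (a : g.Torus m n) : FreeAlgebra.lift k (genOp q g) (fT k g m n a) =
    torusOp q (torusWeight g a) := FreeAlgebra.lift_ι_apply _ _

@[simp] lemma lift_fTinv (a : g.Torus m n) : FreeAlgebra.lift k (genOp q g) (fTinv k g m n a) =
    torusOp q (-torusWeight g a) := FreeAlgebra.lift_ι_apply _ _

@[simp] lemma lift_fSigma : FreeAlgebra.lift k (genOp q g) (fSigma k g m n) = opParity :=
  FreeAlgebra.lift_ι_apply _ _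

lemma lift_fCalK (hq0 : q ≠ 0) (j : Fin (m + n - 1)) :
    FreeAlgebra.lift k (genOp q g) (fCalK k m n g j) = torusOp q (simpleRoot j) := by
  cases g with
  | gl =>
    rw [simpleRoot, sub_eq_add_neg, torusOp_add hq0]
    exact (map_mul _ _ _).trans (congrArg₂ (· * ·) (lift_fT .gl (lo j)) (lift_fTinv .gl (hi j)))
  | sl => exact lift_fT _ _

lemma lift_fCalKinv (hq0 : q ≠ 0) (j : Fin (m + n - 1)) :
    FreeAlgebra.lift k (genOp q g) (fCalKinv k m n g j) = torusOp q (-simpleRoot j) := by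
  cases g with
  | gl =>
    rw [simpleRoot, neg_sub, sub_eq_add_neg, torusOp_add hq0]
    exact (map_mul _ _ _).trans (congrArg₂ (· * ·) (lift_fT .gl (hi j)) (lift_fTinv .gl (lo j)))
  | sl => exact lift_fTinv _ _

end Lift

lemma lo_eq_hi_iff {i j : Fin (m + n - 1)} : lo i = hi j ↔ i.1 = j.1 + 1 := by
  simp [lo, hi]

lemma lo_injective : Function.Injective (lo : Fin (m + n - 1) → Fin (m + n)) := fun i j h => by
  simpa [lo, Fin.ext_iff] using h

lemma hi_injective : Function.Injective (hi : Fin (m + n - 1) → Fin (m + n)) := fun i j h => by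
  simpa [hi, Fin.ext_iff] using h

lemma form_neg_simpleRoot (β : Weight m n) (j : Fin (m + n - 1)) :
    form β (Pi.single (hi j) 1 - Pi.single (lo j) 1) = -form β (simpleRoot j) := by
  rw [← form_neg_right, simpleRoot, neg_sub]

lemma raise_lower_pow_eq_zero (hq0 : q ≠ 0) (hq : q - q⁻¹ ≠ 0) {l : ℕ} (hl : qInt q l = 0)
    (hl2 : 2 ≤ l) {i j : Fin (m + n)} (hij : i ≠ j) : (raise q i * lower k j) ^ l = 0 := by
  rw [(raise_commute_lower q hij).mul_pow, raise_pow_eq_zero hq0 hq i hl hl2, zero_mul]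

lemma torusOp_pow_eq_one (hq0 : q ≠ 0) {r : ℕ} (hr : q ^ r = 1) (β : Weight m n) :
    torusOp q β ^ r = 1 := by
  have h : ∀ s : ℕ, torusOp q β ^ s = torusOp q (s • β) := by
    intro s
    induction s with
    | zero => rw [pow_zero, zero_smul, torusOp_zero]
    | succ s ih => rw [pow_succ, ih, succ_nsmul, torusOp_add hq0]
  have h2 : ∀ (s : ℕ) (c : Weight m n), form (s • β) c = s * form β c := by
    intro s c
    rw [form, form, Finset.mul_sum]
    refine Finset.sum_congr rfl fun i _ => ?_
    simp only [Pi.smul_apply, nsmul_eq_mul]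
    ring
  refine omega_ext fun b => ?_
  rw [h, torusOp_mono, h2, zpow_mul, zpow_natCast, hr, one_zpow, one_smul, Module.End.one_apply]

/-- The Serre relations of the `E_i`. The place shared by `E_i` and `E_j` plays the role of `p` and
`r` in `serre_of_commute`. If it is odd or `i` lies in the odd part, the other operator in `E_i` has
square zero. -/
lemma raise_lower_serre (hq0 : q ≠ 0) {i j : Fin (m + n - 1)}
    (h : i.1 + 1 = j.1 ∨ j.1 + 1 = i.1) (hi' : ¬ IsOdd i) :
    (raise q (lo i) * lower k (hi i)) * (raise q (lo i) * lower k (hi i)) *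
          (raise q (lo j) * lower k (hi j))
        - (q + q⁻¹) • ((raise q (lo i) * lower k (hi i)) * (raise q (lo j) * lower k (hi j)) *
          (raise q (lo i) * lower k (hi i)))
        + (raise q (lo j) * lower k (hi j)) * (raise q (lo i) * lower k (hi i)) *
          (raise q (lo i) * lower k (hi i)) = 0 := by
  have RL : ∀ {i j : Fin (m + n)}, i ≠ j → Commute (raise q i) (lower k j) :=
    fun h => raise_commute_lower q h
  have LR : ∀ {i j : Fin (m + n)}, i ≠ j → Commute (lower k i) (raise q j) :=
    fun h => (raise_commute_lower q h.symm).symm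
  have RR : ∀ i j : Fin (m + n), Commute (raise q i) (raise q j) := raise_commute_raise q
  have LL : ∀ i j : Fin (m + n), Commute (lower k i) (lower k j) := lower_commute_lower
  have ho : ¬ i.1 + 1 = m := hi'
  have hlh := lo_ne_hi i
  have hjj := lo_ne_hi j
  rcases h with h | h
  · have e : hi i = lo j := Eq.symm (lo_eq_hi_iff.2 h.symm)
    have h3 : lo i ≠ hi j := fun h' => by rw [lo_eq_hi_iff] at h'; omega
    rw [e] at hlh ⊢
    refine serre_of_commute (A := Module.End k (Omega k m n))
      (RL hlh) (RR _ _) (RL h3) (LL _ _) (LR hjj.symm) ?_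
    by_cases hm : i.1 + 1 < m
    · exact Or.inl (lower_lower_raise hq0 (i := lo j) (by rw [← e]; exact hm))
    · exact Or.inr (raise_mul_raise_of_odd q (i := lo i) (show m ≤ i.1 by omega))
  · have e : lo i = hi j := lo_eq_hi_iff.2 h.symm
    have h3 : lo j ≠ hi i := fun h' => by rw [lo_eq_hi_iff] at h'; omega
    rw [(RL hlh).eq, (RL hjj).eq]
    rw [e] at hlh ⊢
    refine serre_of_commute (A := Module.End k (Omega k m n))
      (LR hlh.symm) (LL _ _) (LR h3.symm) (RR _ _) (RL hjj) ?_
    by_cases hm : i.1 + 1 < m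
    · exact Or.inl (raise_raise_lower hq0 (i := hi j) (show (hi j).1 < m by
        rw [← e]; exact show i.1 < m by omega))
    · exact Or.inr (lower_mul_lower_of_odd (i := hi i) (show m ≤ i.1 + 1 by omega))

/-- The Serre relations of the `F_i`, with the same choice of places as for the `E_i`. -/
lemma lower_raise_serre (hq0 : q ≠ 0) {i j : Fin (m + n - 1)}
    (h : i.1 + 1 = j.1 ∨ j.1 + 1 = i.1) (hi' : ¬ IsOdd i) :
    (raise q (hi i) * lower k (lo i)) * (raise q (hi i) * lower k (lo i)) *
          (raise q (hi j) * lower k (lo j))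
        - (q + q⁻¹) • ((raise q (hi i) * lower k (lo i)) * (raise q (hi j) * lower k (lo j)) *
          (raise q (hi i) * lower k (lo i)))
        + (raise q (hi j) * lower k (lo j)) * (raise q (hi i) * lower k (lo i)) *
          (raise q (hi i) * lower k (lo i)) = 0 := by
  have RL : ∀ {i j : Fin (m + n)}, i ≠ j → Commute (raise q i) (lower k j) :=
    fun h => raise_commute_lower q h
  have LR : ∀ {i j : Fin (m + n)}, i ≠ j → Commute (lower k i) (raise q j) :=
    fun h => (raise_commute_lower q h.symm).symm
  have RR : ∀ i j : Fin (m + n), Commute (raise q i) (raise q j) := raise_commute_raise q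
  have LL : ∀ i j : Fin (m + n), Commute (lower k i) (lower k j) := lower_commute_lower
  have ho : ¬ i.1 + 1 = m := hi'
  have hlh := lo_ne_hi i
  have hjj := lo_ne_hi j
  rcases h with h | h
  · have e : hi i = lo j := Eq.symm (lo_eq_hi_iff.2 h.symm)
    have h3 : lo i ≠ hi j := fun h' => by rw [lo_eq_hi_iff] at h'; omega
    rw [(RL hlh.symm).eq, (RL hjj.symm).eq]
    rw [e] at hlh ⊢
    refine serre_of_commute (A := Module.End k (Omega k m n))
      (LR hlh) (LL _ _) (LR h3) (RR _ _) (RL hjj.symm) ?_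
    by_cases hm : i.1 + 1 < m
    · exact Or.inl (raise_raise_lower hq0 (i := lo j) (by rw [← e]; exact hm))
    · exact Or.inr (lower_mul_lower_of_odd (i := lo i) (show m ≤ i.1 by omega))
  · have e : lo i = hi j := lo_eq_hi_iff.2 h.symm
    have h3 : lo j ≠ hi i := fun h' => by rw [lo_eq_hi_iff] at h'; omega
    rw [e] at hlh ⊢
    refine serre_of_commute (A := Module.End k (Omega k m n))
      (RL hlh.symm) (RR _ _) (RL h3.symm) (LL _ _) (LR hjj) ?_
    by_cases hm : i.1 + 1 < m
    · exact Or.inl (lower_lower_raise hq0 (i := hi j) (show (hi j).1 < m by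
        rw [← e]; exact show i.1 < m by omega))
    · exact Or.inr (raise_mul_raise_of_odd q (i := hi i) (show m ≤ i.1 + 1 by omega))

lemma raise_lower_super_serre (hq0 : q ≠ 0) {a b c : Fin (m + n - 1)}
    (hab : a.1 + 1 = b.1) (hbc : b.1 + 1 = c.1) (hb : IsOdd b) :
    (raise q (lo a) * lower k (hi a)) * (raise q (lo b) * lower k (hi b)) *
          (raise q (lo c) * lower k (hi c)) * (raise q (lo b) * lower k (hi b))
        + (raise q (lo b) * lower k (hi b)) * (raise q (lo a) * lower k (hi a)) *
          (raise q (lo b) * lower k (hi b)) * (raise q (lo c) * lower k (hi c))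
        + (raise q (lo c) * lower k (hi c)) * (raise q (lo b) * lower k (hi b)) *
          (raise q (lo a) * lower k (hi a)) * (raise q (lo b) * lower k (hi b))
        + (raise q (lo b) * lower k (hi b)) * (raise q (lo c) * lower k (hi c)) *
          (raise q (lo b) * lower k (hi b)) * (raise q (lo a) * lower k (hi a))
        - (q + q⁻¹) • ((raise q (lo b) * lower k (hi b)) * (raise q (lo a) * lower k (hi a)) *
          (raise q (lo c) * lower k (hi c)) * (raise q (lo b) * lower k (hi b))) = 0 := by
  have RL : ∀ {i j : Fin (m + n)}, i ≠ j → Commute (raise q i) (lower k j) :=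
    fun h => raise_commute_lower q h
  have LR : ∀ {i j : Fin (m + n)}, i ≠ j → Commute (lower k i) (raise q j) :=
    fun h => (raise_commute_lower q h.symm).symm
  have RR : ∀ i j : Fin (m + n), Commute (raise q i) (raise q j) := raise_commute_raise q
  have LL : ∀ i j : Fin (m + n), Commute (lower k i) (lower k j) := lower_commute_lower
  have ho : b.1 + 1 = m := hb
  have e1 : hi a = lo b := Eq.symm (lo_eq_hi_iff.2 hab.symm)
  have e2 : hi b = lo c := Eq.symm (lo_eq_hi_iff.2 hbc.symm)
  have n1 : lo a ≠ lo b := e1 ▸ lo_ne_hi a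
  have n2 : lo b ≠ lo c := e2 ▸ lo_ne_hi b
  have n3 : lo c ≠ hi c := lo_ne_hi c
  have n4 : lo a ≠ lo c := fun h' => by have := congrArg Fin.val (lo_injective h'); omega
  have n5 : lo a ≠ hi c := fun h' => by rw [lo_eq_hi_iff] at h'; omega
  have n6 : lo b ≠ hi c := fun h' => by rw [lo_eq_hi_iff] at h'; omega
  rw [e1, e2]
  exact super_serre_of_commute (A := Module.End k (Omega k m n))
    (RL n5) (RR _ _) (RL n4) (RR _ _) (LL _ _) (LR n6.symm)
    (LL _ _) (LR n3.symm) (LL _ _) (LR n2) (RL n2) (RR _ _)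
    (lower_mul_lower_of_odd (i := lo c) (show m ≤ c.1 by omega))
    ((add_comm _ _).trans (raise_raise_lower hq0 (i := lo b) (show b.1 < m by omega)))

lemma lower_raise_super_serre (hq0 : q ≠ 0) {a b c : Fin (m + n - 1)}
    (hab : a.1 + 1 = b.1) (hbc : b.1 + 1 = c.1) (hb : IsOdd b) :
    (raise q (hi a) * lower k (lo a)) * (raise q (hi b) * lower k (lo b)) *
          (raise q (hi c) * lower k (lo c)) * (raise q (hi b) * lower k (lo b))
        + (raise q (hi b) * lower k (lo b)) * (raise q (hi a) * lower k (lo a)) *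
          (raise q (hi b) * lower k (lo b)) * (raise q (hi c) * lower k (lo c))
        + (raise q (hi c) * lower k (lo c)) * (raise q (hi b) * lower k (lo b)) *
          (raise q (hi a) * lower k (lo a)) * (raise q (hi b) * lower k (lo b))
        + (raise q (hi b) * lower k (lo b)) * (raise q (hi c) * lower k (lo c)) *
          (raise q (hi b) * lower k (lo b)) * (raise q (hi a) * lower k (lo a))
        - (q + q⁻¹) • ((raise q (hi b) * lower k (lo b)) * (raise q (hi a) * lower k (lo a)) *
          (raise q (hi c) * lower k (lo c)) * (raise q (hi b) * lower k (lo b))) = 0 := by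
  have RL : ∀ {i j : Fin (m + n)}, i ≠ j → Commute (raise q i) (lower k j) :=
    fun h => raise_commute_lower q h
  have LR : ∀ {i j : Fin (m + n)}, i ≠ j → Commute (lower k i) (raise q j) :=
    fun h => (raise_commute_lower q h.symm).symm
  have RR : ∀ i j : Fin (m + n), Commute (raise q i) (raise q j) := raise_commute_raise q
  have LL : ∀ i j : Fin (m + n), Commute (lower k i) (lower k j) := lower_commute_lower
  have ho : b.1 + 1 = m := hb
  have e1 : hi a = lo b := Eq.symm (lo_eq_hi_iff.2 hab.symm)
  have e2 : hi b = lo c := Eq.symm (lo_eq_hi_iff.2 hbc.symm)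
  have n1 : lo a ≠ lo b := e1 ▸ lo_ne_hi a
  have n2 : lo b ≠ lo c := e2 ▸ lo_ne_hi b
  have n3 : lo c ≠ hi c := lo_ne_hi c
  have n4 : lo a ≠ lo c := fun h' => by have := congrArg Fin.val (lo_injective h'); omega
  have n5 : lo a ≠ hi c := fun h' => by rw [lo_eq_hi_iff] at h'; omega
  have n6 : lo b ≠ hi c := fun h' => by rw [lo_eq_hi_iff] at h'; omega
  rw [e1, e2, (RL n1.symm).eq, (RL n2.symm).eq, (RL n3.symm).eq]
  exact super_serre_of_commute (A := Module.End k (Omega k m n))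
    (LR n5) (LL _ _) (LR n4) (LL _ _) (RR _ _) (RL n6.symm)
    (RR _ _) (RL n3.symm) (RR _ _) (RL n2) (LR n2) (LL _ _)
    (raise_mul_raise_of_odd q (i := lo c) (show m ≤ c.1 by omega))
    ((add_comm _ _).trans (lower_lower_raise hq0 (i := lo b) (show b.1 < m by omega)))

/-- The operators satisfy the defining relations. The restricted relations hold as soon as
`[l] = 0`, even on the whole of `Ω_q(m|n)`. -/
theorem lift_genOp_of_rel (hq0 : q ≠ 0) (hq : q - q⁻¹ ≠ 0) (g : LieType) {l : ℕ}
    (hl : qInt q l = 0) (hl2 : l = 0 ∨ 2 ≤ l) {x y : FreeAlgebra k (Gen g m n)}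
    (h : Rel g l q m n x y) :
    FreeAlgebra.lift k (genOp q g) x = FreeAlgebra.lift k (genOp q g) y := by
  have RL : ∀ {i j : Fin (m + n)}, i ≠ j → Commute (raise q i) (lower k j) :=
    fun h => raise_commute_lower q h
  have LR : ∀ {i j : Fin (m + n)}, i ≠ j → Commute (lower k i) (raise q j) :=
    fun h => (raise_commute_lower q h.symm).symm
  have RR : ∀ i j : Fin (m + n), Commute (raise q i) (raise q j) := raise_commute_raise q
  have LL : ∀ i j : Fin (m + n), Commute (lower k i) (lower k j) := lower_commute_lower
  cases h with
  | T_comm a b => simp only [map_mul, lift_fT, ← torusOp_add hq0, add_comm]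
  | T_Tinv a => simp only [map_mul, lift_fT, lift_fTinv, ← torusOp_add hq0, add_neg_cancel,
      torusOp_zero, map_one]
  | Tinv_T a => simp only [map_mul, lift_fT, lift_fTinv, ← torusOp_add hq0, neg_add_cancel,
      torusOp_zero, map_one]
  | T_E a j =>
    simp only [map_mul, map_smul, lift_fT, lift_fE]
    exact torusOp_mul_raise_lower hq0 _ (lo_ne_hi j)
  | T_F a j =>
    simp only [map_mul, map_smul, lift_fT, lift_fF]
    rw [torusOp_mul_raise_lower hq0 _ (lo_ne_hi j).symm, form_neg_simpleRoot]
  | E_F_same i =>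
    simp only [map_mul, map_smul, map_sub, lift_fE, lift_fF, lift_fCalK g hq0,
      lift_fCalKinv g hq0]
    exact raise_lower_supercommutator hq0 hq i
  | E_F_diff i j h =>
    have hp : par i * par j = 0 := by
      rw [mul_eq_zero]
      by_contra! hc
      refine h (Fin.ext ?_)
      have h1 : i.1 + 1 = m := by by_contra h1; exact hc.1 (if_neg h1)
      have h2 : j.1 + 1 = m := by by_contra h2; exact hc.2 (if_neg h2)
      omega
    simp only [map_mul, map_sub, lift_fE, lift_fF, map_zero, hp, pow_zero, one_smul]
    have h1 : lo i ≠ lo j := fun h' => h (lo_injective h')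
    have h2 : hi i ≠ hi j := fun h' => h (hi_injective h')
    exact sub_eq_zero.2 (((RR _ _).mul_right (RL h1)).mul_left ((LR h2).mul_right (LL _ _))).eq
  | E_comm i j h =>
    simp only [map_mul, lift_fE]
    have h1 : lo i ≠ hi j := fun h' => by rw [lo_eq_hi_iff] at h'; omega
    have h2 : hi i ≠ lo j := fun h' => by rw [eq_comm, lo_eq_hi_iff] at h'; omega
    exact (((RR _ _).mul_right (RL h1)).mul_left ((LR h2).mul_right (LL _ _))).eq
  | F_comm i j h =>
    simp only [map_mul, lift_fF]
    have h1 : lo i ≠ hi j := fun h' => by rw [lo_eq_hi_iff] at h'; omega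
    have h2 : hi i ≠ lo j := fun h' => by rw [eq_comm, lo_eq_hi_iff] at h'; omega
    exact (((RR _ _).mul_right (RL h2)).mul_left ((LR h1).mul_right (LL _ _))).eq
  | E_serre i j h hi' =>
    simp only [map_mul, map_smul, map_sub, map_add, lift_fE, map_zero]
    exact raise_lower_serre hq0 h hi'
  | F_serre i j h hi' =>
    simp only [map_mul, map_smul, map_sub, map_add, lift_fF, map_zero]
    exact lower_raise_serre hq0 h hi'
  | E_odd i hi' =>
    have ho : i.1 + 1 = m := hi'
    simp only [map_mul, lift_fE, map_zero]
    rw [(RL (lo_ne_hi i)).symm.mul_mul_mul_comm,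
      lower_mul_lower_of_odd (i := hi i) (show m ≤ i.1 + 1 by omega), mul_zero]
  | F_odd i hi' =>
    have ho : i.1 + 1 = m := hi'
    simp only [map_mul, lift_fF, map_zero]
    rw [(RL (lo_ne_hi i).symm).symm.mul_mul_mul_comm,
      raise_mul_raise_of_odd q (i := hi i) (show m ≤ i.1 + 1 by omega), zero_mul]
  | E_super a b c hab hbc hb =>
    simp only [map_mul, map_smul, map_sub, map_add, lift_fE, map_zero]
    exact raise_lower_super_serre hq0 hab hbc hb
  | F_super a b c hab hbc hb =>
    simp only [map_mul, map_smul, map_sub, map_add, lift_fF, map_zero]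
    exact lower_raise_super_serre hq0 hab hbc hb
  | sigma_sq => simp only [map_mul, lift_fSigma, map_one, opParity_mul_opParity]
  | sigma_E j =>
    simp only [map_mul, map_smul, lift_fSigma, lift_fE]
    rw [opParity_mul_raise_lower q (lo_ne_hi j), ← neg_one_zpow_oddDegree_simpleRoot, simpleRoot]
  | sigma_F j =>
    simp only [map_mul, map_smul, lift_fSigma, lift_fF]
    rw [opParity_mul_raise_lower q (lo_ne_hi j).symm, ← neg_one_zpow_oddDegree_simpleRoot,
      ← neg_sub, ← simpleRoot, oddDegree_neg, zpow_neg, ← inv_zpow, inv_neg_one]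
  | sigma_T a =>
    simp only [map_mul, lift_fSigma, lift_fT]
    have h : Commute opParity (torusOp q (torusWeight g a)) := omega_ext fun b => by
      simp only [Module.End.mul_apply, torusOp_mono, map_smul, opParity_mono]
      rw [smul_comm]
    rw [h.eq, mul_assoc, opParity_mul_opParity, mul_one]
  | res_E hl' j hj =>
    simp only [map_pow, lift_fE, map_zero]
    exact raise_lower_pow_eq_zero hq0 hq hl (by omega) (lo_ne_hi j)
  | res_F hl' j hj =>
    simp only [map_pow, lift_fF, map_zero]
    exact raise_lower_pow_eq_zero hq0 hq hl (by omega) (lo_ne_hi j).symm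
  | res_T hl' a =>
    simp only [map_pow, lift_fT, map_one]
    exact torusOp_pow_eq_one hq0 (pow_two_mul_eq_one_of_qInt_eq_zero hq0 hq hl) _

/-- The representation of the algebra on `Ω_q(m|n)` by quantum differential operators. -/
def omegaRep (hq0 : q ≠ 0) (hq : q - q⁻¹ ≠ 0) (g : LieType) {l : ℕ}
    (hl : qInt q l = 0) (hl2 : l = 0 ∨ 2 ≤ l) :
    QAlg g l q m n →ₐ[k] Module.End k (Omega k m n) :=
  RingQuot.liftAlgHom k ⟨FreeAlgebra.lift k (genOp q g),
    fun _ _ h => lift_genOp_of_rel hq0 hq g hl hl2 h⟩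

lemma omegaRep_gen (hq0 : q ≠ 0) (hq : q - q⁻¹ ≠ 0) (g : LieType) {l : ℕ}
    (hl : qInt q l = 0) (hl2 : l = 0 ∨ 2 ≤ l) (x : Gen g m n) :
    omegaRep hq0 hq g hl hl2 (gen g l q m n x) = genOp q g x := by
  rw [omegaRep, gen, RingQuot.liftAlgHom_mkAlgHom_apply, FreeAlgebra.lift_ι_apply]

end Representation

/-! ### Verma modules -/

section VermaModules

lemma exists_smul_eq_of_isSimpleModule {R N : Type*} [Ring R] [AddCommGroup N] [Module R N]
    {v x : N} [IsSimpleModule R (Submodule.span R {v})] (hx : x ∈ Submodule.span R {v})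
    (hx0 : x ≠ 0) : ∃ a : R, a • x = v := by
  have hatom : IsAtom (Submodule.span R {v}) := isSimpleModule_iff_isAtom.1 inferInstance
  have hle : Submodule.span R {x} ≤ Submodule.span R {v} := by
    rwa [Submodule.span_singleton_le_iff_mem]
  rcases hatom.le_iff.1 hle with h | h
  · exact absurd (Submodule.span_singleton_eq_bot.1 h) hx0
  · exact Submodule.mem_span_singleton.1 (h ▸ Submodule.mem_span_singleton_self v)

variable {k : Type*} [Field k] {g : LieType} {l : ℕ} {q : k} {m n : ℕ}

section Relations

lemma mkAlgHom_eq_of_rel {x y : FreeAlgebra k (Gen g m n)} (h : Rel g l q m n x y) :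
    RingQuot.mkAlgHom k (Rel g l q m n) x = RingQuot.mkAlgHom k (Rel g l q m n) y :=
  RingQuot.mkAlgHom_rel k h

lemma mkAlgHom_fE (j : Fin (m + n - 1)) :
    RingQuot.mkAlgHom k (Rel g l q m n) (fE k g m n j) = gen g l q m n (.E j) := rfl

lemma mkAlgHom_fF (j : Fin (m + n - 1)) :
    RingQuot.mkAlgHom k (Rel g l q m n) (fF k g m n j) = gen g l q m n (.F j) := rfl

lemma mkAlgHom_fT (a : g.Torus m n) :
    RingQuot.mkAlgHom k (Rel g l q m n) (fT k g m n a) = gen g l q m n (.T a) := rfl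

lemma mkAlgHom_fTinv (a : g.Torus m n) :
    RingQuot.mkAlgHom k (Rel g l q m n) (fTinv k g m n a) = gen g l q m n (.Tinv a) := rfl

lemma mkAlgHom_fSigma :
    RingQuot.mkAlgHom k (Rel g l q m n) (fSigma k g m n) = gen g l q m n .sigma := rfl

lemma gen_T_mul_gen_F (a : g.Torus m n) (j : Fin (m + n - 1)) :
    gen g l q m n (.T a) * gen g l q m n (.F j) =
      q ^ (-form (torusWeight g a) (simpleRoot j)) •
        (gen g l q m n (.F j) * gen g l q m n (.T a)) := by
  simpa only [map_mul, map_smul, mkAlgHom_fF, mkAlgHom_fT] using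
    mkAlgHom_eq_of_rel (Rel.T_F (l := l) (q := q) a j)

lemma gen_Tinv_mul_gen_T (a : g.Torus m n) :
    gen g l q m n (.Tinv a) * gen g l q m n (.T a) = 1 := by
  simpa only [map_mul, map_one, mkAlgHom_fTinv, mkAlgHom_fT] using
    mkAlgHom_eq_of_rel (Rel.Tinv_T (l := l) (q := q) a)

lemma gen_sigma_mul_gen_F (j : Fin (m + n - 1)) :
    gen g l q m n .sigma * gen g l q m n (.F j) =
      (-1 : k) ^ par j • (gen g l q m n (.F j) * gen g l q m n .sigma) := by
  have h1 : gen g l q m n .sigma * gen g l q m n (.F j) * gen g l q m n .sigma =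
      (-1 : k) ^ par j • gen g l q m n (.F j) := by
    simpa only [map_mul, map_smul, mkAlgHom_fSigma, mkAlgHom_fF] using
      mkAlgHom_eq_of_rel (Rel.sigma_F (g := g) (l := l) (q := q) j)
  have h2 : gen g l q m n .sigma * gen g l q m n .sigma = 1 := by
    simpa only [map_mul, map_one, mkAlgHom_fSigma] using
      mkAlgHom_eq_of_rel (Rel.sigma_sq (g := g) (l := l) (q := q) (m := m) (n := n))
  rw [← smul_mul_assoc, ← h1, mul_assoc _ (gen g l q m n .sigma), h2, mul_one]

/-- The commutation of `E_i` past `F_j`: the remaining term lies in the torus. -/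
lemma gen_E_mul_gen_F (i j : Fin (m + n - 1)) : ∃ c d : k,
    gen g l q m n (.E i) * gen g l q m n (.F j) =
      c • (gen g l q m n (.F j) * gen g l q m n (.E i)) +
      d • (RingQuot.mkAlgHom k (Rel g l q m n) (fCalK k m n g i) -
        RingQuot.mkAlgHom k (Rel g l q m n) (fCalKinv k m n g i)) := by
  by_cases h : i = j
  · subst h
    refine ⟨(-1 : k) ^ (par i * par i), (qSub q m i.1 - (qSub q m i.1)⁻¹)⁻¹, ?_⟩
    have h1 := mkAlgHom_eq_of_rel (Rel.E_F_same (g := g) (l := l) (q := q) i)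
    simp only [map_sub, map_mul, map_smul, mkAlgHom_fE, mkAlgHom_fF] at h1
    rw [← h1]
    abel
  · refine ⟨(-1 : k) ^ (par i * par j), 0, ?_⟩
    have h1 := mkAlgHom_eq_of_rel (Rel.E_F_diff (g := g) (l := l) (q := q) i j h)
    simp only [map_sub, map_mul, map_smul, mkAlgHom_fE, mkAlgHom_fF, map_zero] at h1
    rw [sub_eq_zero.1 h1, zero_smul, add_zero]

end Relations

variable (g l q m n) in
/-- The monomial `F_(j₁) ⋯ F_(jᵣ)`. -/
def fWord (w : List (Fin (m + n - 1))) : QAlg g l q m n :=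
  (w.map fun j => gen g l q m n (.F j)).prod

lemma fWord_nil_smul {N : Type*} [AddCommGroup N]
    [Module (QAlg g l q m n) N] (v : N) : fWord g l q m n [] • v = v := by
  rw [fWord, List.map_nil, List.prod_nil, one_smul]

lemma fWord_cons_smul (j : Fin (m + n - 1)) (w : List (Fin (m + n - 1))) {N : Type*}
    [AddCommGroup N] [Module (QAlg g l q m n) N] (v : N) :
    fWord g l q m n (j :: w) • v = gen g l q m n (.F j) • fWord g l q m n w • v := by
  rw [fWord, List.map_cons, List.prod_cons, mul_smul, fWord]

variable {N : Type*} [AddCommGroup N] [Module k N] [Module (QAlg g l q m n) N]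
  [IsScalarTower k (QAlg g l q m n) N]

lemma smul_mem_of_gen_smul_mem {S : Submodule k N}
    (h : ∀ x, ∀ s ∈ S, gen g l q m n x • s ∈ S) (a : QAlg g l q m n) {s : N} (hs : s ∈ S) :
    a • s ∈ S := by
  obtain ⟨b, rfl⟩ := RingQuot.mkAlgHom_surjective k (Rel g l q m n) a
  induction b using FreeAlgebra.induction generalizing s with
  | grade0 r =>
    rw [AlgHom.commutes, algebraMap_smul]
    exact S.smul_mem r hs
  | grade1 x => exact h x s hs
  | mul a b ha hb =>
    rw [map_mul, mul_smul]
    exact ha (hb hs)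
  | add a b ha hb =>
    rw [map_add, add_smul]
    exact S.add_mem (ha hs) (hb hs)

section HighestWeightVectors

variable {lam : Weight m n} {v : N}

lemma gen_T_smul_fWord (hq0 : q ≠ 0)
    (hT : ∀ a, gen g l q m n (.T a) • v = q ^ form (torusWeight g a) lam • v) (a : g.Torus m n)
    (w : List (Fin (m + n - 1))) : ∃ c : k, c ≠ 0 ∧
      gen g l q m n (.T a) • fWord g l q m n w • v = c • fWord g l q m n w • v := by
  induction w with
  | nil => exact ⟨_, zpow_ne_zero _ hq0, by rw [fWord_nil_smul, hT]⟩
  | cons j w ih =>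
    obtain ⟨c, hc, h⟩ := ih
    refine ⟨_, mul_ne_zero (zpow_ne_zero (-form (torusWeight g a) (simpleRoot j)) hq0) hc, ?_⟩
    rw [fWord_cons_smul, ← mul_smul, gen_T_mul_gen_F, smul_assoc, mul_smul, h,
      smul_algebra_smul_comm, smul_smul]

lemma gen_Tinv_smul_fWord (hq0 : q ≠ 0)
    (hT : ∀ a, gen g l q m n (.T a) • v = q ^ form (torusWeight g a) lam • v) (a : g.Torus m n)
    (w : List (Fin (m + n - 1))) : ∃ c : k,
      gen g l q m n (.Tinv a) • fWord g l q m n w • v = c • fWord g l q m n w • v := by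
  obtain ⟨c, hc, h⟩ := gen_T_smul_fWord hq0 hT a w
  refine ⟨c⁻¹, ?_⟩
  have h1 : fWord g l q m n w • v = c⁻¹ • gen g l q m n (.T a) • fWord g l q m n w • v := by
    rw [h, smul_smul, inv_mul_cancel₀ hc, one_smul]
  conv_lhs => rw [h1]
  rw [smul_algebra_smul_comm, ← mul_smul (gen g l q m n (.Tinv a)), gen_Tinv_mul_gen_T, one_smul]

lemma calK_smul_fWord (hq0 : q ≠ 0)
    (hT : ∀ a, gen g l q m n (.T a) • v = q ^ form (torusWeight g a) lam • v)
    (i : Fin (m + n - 1)) (w : List (Fin (m + n - 1))) : ∃ c : k,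
      (RingQuot.mkAlgHom k (Rel g l q m n) (fCalK k m n g i) -
        RingQuot.mkAlgHom k (Rel g l q m n) (fCalKinv k m n g i)) • fWord g l q m n w • v =
      c • fWord g l q m n w • v := by
  cases g with
  | gl =>
    obtain ⟨c1, -, h1⟩ := gen_T_smul_fWord hq0 hT (lo i) w
    obtain ⟨c2, -, h2⟩ := gen_T_smul_fWord hq0 hT (hi i) w
    obtain ⟨c3, h3⟩ := gen_Tinv_smul_fWord hq0 hT (lo i) w
    obtain ⟨c4, h4⟩ := gen_Tinv_smul_fWord hq0 hT (hi i) w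
    have e1 : RingQuot.mkAlgHom k (Rel .gl l q m n) (fCalK k m n .gl i) =
      gen .gl l q m n (.T (lo i)) * gen .gl l q m n (.Tinv (hi i)) := map_mul _ _ _
    have e2 : RingQuot.mkAlgHom k (Rel .gl l q m n) (fCalKinv k m n .gl i) =
      gen .gl l q m n (.T (hi i)) * gen .gl l q m n (.Tinv (lo i)) := map_mul _ _ _
    refine ⟨c4 * c1 - c3 * c2, ?_⟩
    rw [e1, e2, sub_smul, mul_smul, mul_smul, h3, h4, smul_algebra_smul_comm,
      smul_algebra_smul_comm, h1, h2, smul_smul, smul_smul, sub_smul]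
  | sl =>
    obtain ⟨c1, -, h1⟩ := gen_T_smul_fWord hq0 hT i w
    obtain ⟨c2, h2⟩ := gen_Tinv_smul_fWord hq0 hT i w
    refine ⟨c1 - c2, ?_⟩
    rw [sub_smul, sub_smul, ← h1, ← h2]
    rfl

lemma gen_sigma_smul_fWord
    (hs : gen g l q m n .sigma • v = (-1 : k) ^ oddDegree lam • v)
    (w : List (Fin (m + n - 1))) : ∃ c : k,
      gen g l q m n .sigma • fWord g l q m n w • v = c • fWord g l q m n w • v := by
  induction w with
  | nil => exact ⟨_, by rw [fWord_nil_smul, hs]⟩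
  | cons j w ih =>
    obtain ⟨c, h⟩ := ih
    refine ⟨(-1) ^ par j * c, ?_⟩
    rw [fWord_cons_smul, ← mul_smul, gen_sigma_mul_gen_F, smul_assoc, mul_smul, h,
      smul_algebra_smul_comm, smul_smul]

lemma gen_F_smul_mem_span_fWord (j : Fin (m + n - 1)) {s : N}
    (hs : s ∈ Submodule.span k (Set.range fun w => fWord g l q m n w • v)) :
    gen g l q m n (.F j) • s ∈ Submodule.span k (Set.range fun w => fWord g l q m n w • v) := by
  induction hs using Submodule.span_induction with
  | mem x hx =>
    obtain ⟨w, rfl⟩ := hx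
    exact Submodule.subset_span ⟨j :: w, fWord_cons_smul j w v⟩
  | zero => rw [smul_zero]; exact zero_mem _
  | add x y _ _ hx hy => rw [smul_add]; exact add_mem hx hy
  | smul c x _ hx => rw [smul_algebra_smul_comm]; exact Submodule.smul_mem _ c hx

lemma gen_E_smul_fWord_mem (hq0 : q ≠ 0) (hE : ∀ j, gen g l q m n (.E j) • v = 0)
    (hT : ∀ a, gen g l q m n (.T a) • v = q ^ form (torusWeight g a) lam • v)
    (i : Fin (m + n - 1)) (w : List (Fin (m + n - 1))) :
    gen g l q m n (.E i) • fWord g l q m n w • v ∈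
      Submodule.span k (Set.range fun w => fWord g l q m n w • v) := by
  induction w with
  | nil => rw [fWord_nil_smul, hE]; exact zero_mem _
  | cons j w ih =>
    obtain ⟨c, d, h⟩ := gen_E_mul_gen_F (g := g) (l := l) (q := q) i j
    obtain ⟨e, he⟩ := calK_smul_fWord hq0 hT i w
    rw [fWord_cons_smul, ← mul_smul, h, add_smul, smul_assoc, smul_assoc, mul_smul, he]
    exact add_mem (Submodule.smul_mem _ _ (gen_F_smul_mem_span_fWord j ih))
      (Submodule.smul_mem _ _ (Submodule.smul_mem _ _ (Submodule.subset_span ⟨w, rfl⟩)))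

/-- A highest weight module is spanned by the `F_(j₁) ⋯ F_(jᵣ) v`, `r ≥ 0`. -/
theorem smul_mem_span_fWord (hq0 : q ≠ 0) (hE : ∀ j, gen g l q m n (.E j) • v = 0)
    (hT : ∀ a, gen g l q m n (.T a) • v = q ^ form (torusWeight g a) lam • v)
    (hs : gen g l q m n .sigma • v = (-1 : k) ^ oddDegree lam • v) (a : QAlg g l q m n) :
    a • v ∈ Submodule.span k (Set.range fun w => fWord g l q m n w • v) := by
  have key : ∀ x : QAlg g l q m n, (∀ w, x • fWord g l q m n w • v ∈
      Submodule.span k (Set.range fun w => fWord g l q m n w • v)) →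
      ∀ s ∈ Submodule.span k (Set.range fun w => fWord g l q m n w • v), x • s ∈
        Submodule.span k (Set.range fun w => fWord g l q m n w • v) := by
    intro x hx s hs
    induction hs using Submodule.span_induction with
    | mem y hy => obtain ⟨w, rfl⟩ := hy; exact hx w
    | zero => rw [smul_zero]; exact zero_mem _
    | add x y _ _ hx hy => rw [smul_add]; exact add_mem hx hy
    | smul c x _ hx => rw [smul_algebra_smul_comm]; exact Submodule.smul_mem _ c hx
  have scalar : ∀ x : QAlg g l q m n, ∀ w, (∃ c : k, x • fWord g l q m n w • v =
      c • fWord g l q m n w • v) → x • fWord g l q m n w • v ∈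
      Submodule.span k (Set.range fun w => fWord g l q m n w • v) := by
    rintro x w ⟨c, h⟩
    rw [h]
    exact Submodule.smul_mem _ _ (Submodule.subset_span ⟨w, rfl⟩)
  refine smul_mem_of_gen_smul_mem (fun x => key _ fun w => ?_) a
    (Submodule.subset_span ⟨[], fWord_nil_smul v⟩)
  cases x with
  | E i => exact gen_E_smul_fWord_mem hq0 hE hT i w
  | F i => exact Submodule.subset_span ⟨i :: w, fWord_cons_smul i w v⟩
  | T a =>
    obtain ⟨c, -, h⟩ := gen_T_smul_fWord hq0 hT a w
    exact scalar _ w ⟨c, h⟩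
  | Tinv a => exact scalar _ w (gen_Tinv_smul_fWord hq0 hT a w)
  | sigma => exact scalar _ w (gen_sigma_smul_fWord hs w)

lemma exists_smul_sub_mem_span (hq0 : q ≠ 0) (hE : ∀ j, gen g l q m n (.E j) • v = 0)
    (hT : ∀ a, gen g l q m n (.T a) • v = q ^ form (torusWeight g a) lam • v)
    (hs : gen g l q m n .sigma • v = (-1 : k) ^ oddDegree lam • v) (a : QAlg g l q m n) :
    ∃ c : k, a • v - c • v ∈ Submodule.span k
      {x | ∃ w : List (Fin (m + n - 1)), w ≠ [] ∧ x = fWord g l q m n w • v} := by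
  have h := smul_mem_span_fWord hq0 hE hT hs a
  generalize a • v = y at h
  induction h using Submodule.span_induction with
  | mem x hx =>
    obtain ⟨w, rfl⟩ := hx
    by_cases hw : w = []
    · subst hw
      exact ⟨1, by simp only [fWord_nil_smul, one_smul, sub_self]; exact zero_mem _⟩
    · refine ⟨0, ?_⟩
      rw [zero_smul, sub_zero]
      exact Submodule.subset_span ⟨w, hw, rfl⟩
  | zero => exact ⟨0, by rw [zero_smul, sub_zero]; exact zero_mem _⟩
  | add x y _ _ hx hy =>
    obtain ⟨c, hc⟩ := hx
    obtain ⟨d, hd⟩ := hy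
    refine ⟨c + d, ?_⟩
    rw [add_smul, add_sub_add_comm]
    exact add_mem hc hd
  | smul c x _ hx =>
    obtain ⟨d, hd⟩ := hx
    refine ⟨c * d, ?_⟩
    rw [mul_smul, ← smul_sub]
    exact Submodule.smul_mem _ _ hd

end HighestWeightVectors

section VermaQuotients

variable (g l q m n) in
/-- The canonical generator of the Verma module. -/
def vermaGen (lam : Weight m n) : Verma g l q m n lam := Submodule.Quotient.mk 1

variable {lam : Weight m n}

lemma smul_vermaGen (a : QAlg g l q m n) :
    a • vermaGen g l q m n lam = Submodule.Quotient.mk a := by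
  rw [vermaGen, ← Submodule.Quotient.mk_smul, smul_eq_mul, mul_one]

/-- Every element of the Verma module is the sum of a multiple of the generator and an element below
the highest weight. -/
lemma exists_sub_mem_vermaLower (hq0 : q ≠ 0) (x : Verma g l q m n lam) :
    ∃ c : k, x - c • vermaGen g l q m n lam ∈ vermaLower g l q m n lam := by
  obtain ⟨a, rfl⟩ := Submodule.Quotient.mk_surjective _ x
  rw [← smul_vermaGen]
  have hE : ∀ j, gen g l q m n (.E j) • vermaGen g l q m n lam = 0 := fun j => by
    rw [smul_vermaGen, Submodule.Quotient.mk_eq_zero]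
    exact Submodule.subset_span (Or.inl (Or.inl ⟨j, rfl⟩))
  have hT : ∀ a, gen g l q m n (.T a) • vermaGen g l q m n lam =
      q ^ form (torusWeight g a) lam • vermaGen g l q m n lam := fun a => by
    refine Eq.trans ?_ (algebraMap_smul (R := k) (QAlg g l q m n) _ (vermaGen g l q m n lam))
    rw [smul_vermaGen, smul_vermaGen, Submodule.Quotient.eq]
    exact Submodule.subset_span (Or.inl (Or.inr ⟨a, rfl⟩))
  have hs : gen g l q m n .sigma • vermaGen g l q m n lam =
      (-1 : k) ^ oddDegree lam • vermaGen g l q m n lam := by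
    refine Eq.trans ?_ (algebraMap_smul (R := k) (QAlg g l q m n) _ (vermaGen g l q m n lam))
    rw [smul_vermaGen, smul_vermaGen, Submodule.Quotient.eq]
    exact Submodule.subset_span (Or.inr rfl)
  exact exists_smul_sub_mem_span hq0 hE hT hs a

/-- A simple module generated by a highest weight vector `v` is `V(lam)`, provided that a linear
form separates `v` from all `F_(j₁) ⋯ F_(jᵣ) v` with `r ≥ 1`. -/
theorem nonempty_equiv_V (hq0 : q ≠ 0) {v : N} (hv : IsHighestWeightVector g l q m n lam v)
    [IsSimpleModule (QAlg g l q m n) (Submodule.span (QAlg g l q m n) {v})] (φ : N →ₗ[k] k)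
    (hφv : φ v ≠ 0) (hφ : ∀ w : List (Fin (m + n - 1)), w ≠ [] → φ (fWord g l q m n w • v) = 0) :
    Nonempty (Submodule.span (QAlg g l q m n) {v} ≃ₗ[QAlg g l q m n] V g l q m n lam) := by
  obtain ⟨-, hE, hT, hs⟩ := hv
  have hle : vermaIdeal g l q m n lam ≤
      LinearMap.ker (LinearMap.toSpanSingleton (QAlg g l q m n) N v) := by
    refine Submodule.span_le.2 ?_
    rintro x ((⟨j, rfl⟩ | ⟨a, rfl⟩) | hx)
    · exact hE j
    · simp [sub_smul, hT]
    · rw [Set.mem_singleton_iff] at hx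
      subst hx
      simp [sub_smul, hs]
  let f : Verma g l q m n lam →ₗ[QAlg g l q m n] N := (vermaIdeal g l q m n lam).liftQ _ hle
  have hf : f (vermaGen g l q m n lam) = v := by
    change LinearMap.toSpanSingleton (QAlg g l q m n) N v 1 = v
    rw [LinearMap.toSpanSingleton_apply, one_smul]
  have hrange : LinearMap.range f = Submodule.span (QAlg g l q m n) {v} := by
    rw [Submodule.range_liftQ, LinearMap.range_toSpanSingleton]
  have hlow : ∀ x ∈ vermaLower g l q m n lam, φ (f x) = 0 := by
    intro x hx
    induction hx using Submodule.span_induction with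
    | mem x hx =>
      obtain ⟨w, hw, rfl⟩ := hx
      change φ (f (fWord g l q m n w • vermaGen g l q m n lam)) = 0
      rw [map_smul, hf, hφ w hw]
    | zero => rw [map_zero, map_zero]
    | add x y _ _ hx hy => rw [map_add, map_add, hx, hy, add_zero]
    | smul c x _ hx => rw [LinearMap.map_smul_of_tower, map_smul, hx, smul_zero]
  have hker : vermaRadical g l q m n lam = LinearMap.ker f := by
    refine le_antisymm (sSup_le fun P hP x hx => ?_) (le_sSup fun x hx => ?_)
    · -- the image of `P` is zero or everything, and it does not contain `v`
      by_contra hne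
      have hfx : f x ∈ Submodule.span (QAlg g l q m n) {v} := hrange ▸ ⟨x, rfl⟩
      obtain ⟨a, ha⟩ := exists_smul_eq_of_isSimpleModule hfx hne
      have ha' : f (a • x) = v := by
        rw [map_smul, ha]
      exact hφv (ha' ▸ hlow _ (hP _ (P.smul_mem a hx)))
    · obtain ⟨c, hc⟩ := exists_sub_mem_vermaLower hq0 x
      have h1 := hlow _ hc
      rw [map_sub, LinearMap.map_smul_of_tower, LinearMap.mem_ker.1 hx, hf, zero_sub, map_neg,
        map_smul, neg_eq_zero, smul_eq_mul, mul_eq_zero] at h1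
      rwa [h1.resolve_right hφv, zero_smul k (vermaGen g l q m n lam), sub_zero] at hc
  exact ⟨((LinearEquiv.ofEq _ _ hrange.symm).trans f.quotKerEquivRange.symm).trans
    (Submodule.quotEquivOfEq _ _ hker.symm)⟩

end VermaQuotients

end VermaModules

/-! ### Supports of vectors under the action -/

section Supports

variable {k : Type*} [Field k] {q : k} {m n : ℕ}

lemma mono_apply (c : Fin (m + n) → ℕ) (b : Expo m n) :
    mono k c b = if c = b.1 then 1 else 0 := by
  by_cases hc : ∀ i : Fin (m + n), m ≤ i.1 → c i ≤ 1
  · rw [mono, dif_pos hc, Finsupp.single_apply]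
    simp only [Subtype.ext_iff]
  · rw [mono, dif_neg hc, if_neg fun h : c = b.1 => hc (h ▸ b.2), Finsupp.zero_apply]

lemma mono_mem_supported (c : Fin (m + n) → ℕ) :
    mono k c ∈ Finsupp.supported k k {b : Expo m n | b.1 = c} := by
  rw [Finsupp.mem_supported']
  intro b hb
  rw [mono_apply, if_neg fun h => hb h.symm]

lemma apply_mem_of_forall_mono {s : Set (Expo m n)} {S : Submodule k (Omega k m n)}
    {f : Module.End k (Omega k m n)} (h : ∀ b ∈ s, f (mono k b.1) ∈ S) {x : Omega k m n}
    (hx : x ∈ Finsupp.supported k k s) : f x ∈ S := by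
  rw [Finsupp.supported_eq_span_single] at hx
  have hle : Submodule.span k ((fun b : Expo m n => Finsupp.single b (1 : k)) '' s) ≤
      S.comap f := by
    rw [Submodule.span_le]
    rintro _ ⟨b, hb, rfl⟩
    have := h b hb
    rwa [mono_of_valid] at this
  exact hle hx

lemma raise_lower_mem_supported {i j : Fin (m + n)} (hij : i ≠ j) {s : Set (Expo m n)}
    {x : Omega k m n} (hx : x ∈ Finsupp.supported k k s) :
    (raise q i * lower k j) x ∈ Finsupp.supported k k
      {b' : Expo m n | ∃ b ∈ s, b.1 j ≠ 0 ∧ raiseCoeff q i (b.1 i + 1) ≠ 0 ∧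
        b'.1 = move b.1 i j} := by
  refine apply_mem_of_forall_mono (fun b hb => ?_) hx
  rw [raise_mul_lower_mono_of_ne hij]
  by_cases hj : b.1 j = 0
  · simp [lowerCoeff, hj]
  by_cases hc : raiseCoeff q i (b.1 i + 1) = 0
  · simp [hc]
  refine Submodule.smul_mem _ _ (Finsupp.supported_mono ?_ (mono_mem_supported _))
  exact fun b' hb' => ⟨b, hb, hj, hc, hb'⟩

lemma diag_mem_supported (c : Expo m n → k) {s : Set (Expo m n)} {x : Omega k m n}
    (hx : x ∈ Finsupp.supported k k s) : diag c x ∈ Finsupp.supported k k s := by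
  refine apply_mem_of_forall_mono (f := diag c) (fun b hb => ?_) hx
  rw [diag_mono]
  refine Submodule.smul_mem _ _ (Finsupp.supported_mono ?_ (mono_mem_supported _))
  exact fun b' hb' => (Subtype.ext hb' : b' = b) ▸ hb

/-- Moving a unit from `j` to `i` is injective on the exponents, so that no cancellation between
monomials occurs. -/
lemma raise_lower_apply {i j : Fin (m + n)} (hij : i ≠ j) (x : Omega k m n) {b b' : Expo m n}
    (hj : b.1 j ≠ 0) (hb : b'.1 = move b.1 i j) :
    (raise q i * lower k j) x b' = raiseCoeff q i (b.1 i + 1) * x b := by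
  have h : (Finsupp.lapply b' : Omega k m n →ₗ[k] k) ∘ₗ (raise q i * lower k j) =
      raiseCoeff q i (b.1 i + 1) • (Finsupp.lapply b : Omega k m n →ₗ[k] k) := by
    refine omega_ext fun a => ?_
    rw [LinearMap.comp_apply, raise_mul_lower_mono_of_ne hij, map_smul, LinearMap.smul_apply,
      Finsupp.lapply_apply, Finsupp.lapply_apply, mono_apply, mono_apply, hb]
    by_cases hab : a = b
    · subst hab
      have h1 := a.2 j
      have h2 : ¬ (a.1 j = 0 ∨ m ≤ j.1 ∧ 1 < a.1 j) := by omega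
      simp [lowerCoeff, h2]
    · have hab' : ¬ a.1 = b.1 := fun h => hab (Subtype.ext h)
      rw [if_neg hab', smul_zero]
      by_cases ha : a.1 j = 0
      · simp [lowerCoeff, ha]
      · rw [if_neg, smul_zero]
        intro hm
        have h1 := expoWeight_move hij ha
        rw [hm, expoWeight_move hij hj] at h1
        have h2 := add_right_cancel h1
        exact hab' (funext fun y => by
          have := congrFun h2 y
          simpa [expoWeight] using this.symm)
  exact LinearMap.congr_fun h x

lemma sum_mul_move (c : Fin (m + n) → ℕ) {b : Fin (m + n) → ℕ} {i j : Fin (m + n)} (hij : i ≠ j)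
    (hj : b j ≠ 0) : ∑ x, c x * move b i j x + c j = ∑ x, c x * b x + c i := by
  have h : ∀ x, (move b i j x : ℤ) = b x + ((Pi.single i 1 : Fin (m + n) → ℤ) x
      - (Pi.single j 1 : Fin (m + n) → ℤ) x) := fun x => congrFun (expoWeight_move hij hj) x
  zify
  simp only [h, mul_add, mul_sub, Finset.sum_add_distrib, Finset.sum_sub_distrib, Pi.single_apply,
    mul_ite, mul_one, mul_zero, Finset.sum_ite_eq', Finset.mem_univ, if_true]
  ring

lemma sum_move {b : Fin (m + n) → ℕ} {i j : Fin (m + n)} (hij : i ≠ j)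
    (hj : b j ≠ 0) : ∑ x, move b i j x = ∑ x, b x := by
  have := sum_mul_move (fun _ => 1) hij hj
  simpa using this

/-- The height `∑ i bᵢ` of a monomial: every `E_j` lowers it by one, every `F_j` raises it by
one. -/
def height (b : Fin (m + n) → ℕ) : ℕ := ∑ i, i.1 * b i

lemma height_move_lo_hi {b : Fin (m + n) → ℕ} {j : Fin (m + n - 1)} (hj : b (hi j) ≠ 0) :
    height (move b (lo j) (hi j)) + 1 = height b := by
  have h := sum_mul_move (fun i => i.1) (lo_ne_hi j) hj
  have h1 : (lo j).1 = j.1 := rfl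
  have h2 : (hi j).1 = j.1 + 1 := rfl
  rw [h1, h2] at h
  simp only [height]
  omega

lemma height_move_hi_lo {b : Fin (m + n) → ℕ} {j : Fin (m + n - 1)} (hj : b (lo j) ≠ 0) :
    height (move b (hi j) (lo j)) = height b + 1 := by
  have h := sum_mul_move (fun i => i.1) (lo_ne_hi j).symm hj
  have h1 : (lo j).1 = j.1 := rfl
  have h2 : (hi j).1 = j.1 + 1 := rfl
  rw [h1, h2] at h
  simp only [height]
  omega

lemma move_move {b : Fin (m + n) → ℕ} {i j : Fin (m + n)} (hij : i ≠ j) (hj : b j ≠ 0) :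
    move (move b i j) j i = b := by
  funext x
  by_cases hx : x = i
  · subst hx; simp [move, hij]
  · by_cases hx' : x = j
    · subst hx'
      simp [move, hij.symm]
      omega
    · simp [move, hx, hx']

lemma component_eq_supported (t : ℕ) :
    component k m n t = Finsupp.supported k k {b : Expo m n | ∑ i, b.1 i = t} := by
  rw [component, Finsupp.supported_eq_span_single]
  congr 1
  ext x
  constructor
  · rintro ⟨a, ha, rfl⟩
    exact ⟨a, ha, (mono_of_valid a).symm⟩
  · rintro ⟨a, ha, rfl⟩
    exact ⟨a, ha, (mono_of_valid a).symm⟩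

/-- The exponents of the monomials of `Ω_q(m|n, 1)`; for `l = 0` those of all monomials of
`Ω_q(m|n)`. -/
def Allowed (l : ℕ) (b : Fin (m + n) → ℕ) : Prop := ∀ i : Fin (m + n), i.1 < m → l = 0 ∨ b i < l

lemma restricted_eq_supported {l : ℕ} (hl : 0 < l) :
    restricted k l m n = Finsupp.supported k k {b : Expo m n | Allowed l b.1} := by
  rw [restricted, Finsupp.supported_eq_span_single]
  congr 1
  ext x
  constructor
  · rintro ⟨a, ha, rfl⟩
    exact ⟨a, fun i hi => Or.inr (ha i hi), (mono_of_valid a).symm⟩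
  · rintro ⟨a, ha, rfl⟩
    exact ⟨a, fun i hi => (ha i hi).resolve_left hl.ne', (mono_of_valid a).symm⟩

/-- No operator leads out of `Ω_q(m|n, 1)`, because `[l] = 0`. -/
lemma allowed_move {l : ℕ} (hl : qInt q l = 0) {i j : Fin (m + n)} {b : Fin (m + n) → ℕ}
    (hb : Allowed l b) (hc : raiseCoeff q i (b i + 1) ≠ 0) : Allowed l (move b i j) := by
  intro x hx
  rcases hb x hx with h | h
  · exact Or.inl h
  · right
    by_cases hxi : x = i
    · subst hxi
      rw [raiseCoeff, if_pos hx] at hc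
      have : b x + 1 ≠ l := fun h0 => hc (h0 ▸ hl)
      simp only [move, Function.update_self]
      omega
    · by_cases hxj : x = j
      · subst hxj
        simp only [move, Function.update_of_ne hxi, Function.update_self]
        omega
      · simpa only [move, Function.update_of_ne hxi, Function.update_of_ne hxj] using h

lemma raiseCoeff_ne_zero {l : ℕ} (hl : qChar q = l) {b : Expo m n} (hb : Allowed l b.1)
    {i : Fin (m + n)} (hi : b.1 i ≠ 0) : raiseCoeff q i (b.1 i) ≠ 0 := by
  rw [raiseCoeff]
  by_cases h : i.1 < m
  · rw [if_pos h]
    exact qInt_ne_zero_of_qChar hl (Nat.pos_of_ne_zero hi) (hb i h)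
  · have := b.2 i (not_lt.1 h)
    rw [if_neg h, if_pos (by omega)]
    exact one_ne_zero

end Supports

/-! ### Staircases -/

section Staircases

variable {m n : ℕ}

/-- The largest value that the exponent `bᵢ` of an allowed monomial of degree `t` may take. In the
case `l = 0` of no bound on the even exponents it is replaced by `t + 1`, which is never reached. -/
def cap (m l t i : ℕ) : ℕ := if i < m then (if l = 0 then t + 1 else l - 1) else 1

/-- The places before a nonzero exponent are filled up. These are the exponents of the monomials
of degree `t` that no `E_j` can raise. -/
def IsStair (l t : ℕ) (b : Fin (m + n) → ℕ) : Prop :=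
  ∀ x y : Fin (m + n), x < y → b y ≠ 0 → b x = cap m l t x

lemma le_cap {l t : ℕ} {b : Expo m n} (hb : Allowed l b.1) (ht : ∑ i, b.1 i = t)
    (i : Fin (m + n)) : b.1 i ≤ cap m l t i := by
  rw [cap]
  split_ifs with h1 h2
  · rw [← ht]
    exact (Finset.single_le_sum (f := b.1) (fun _ _ => Nat.zero_le _) (Finset.mem_univ i)).trans
      (Nat.le_succ _)
  · have := (hb i h1).resolve_left h2
    omega
  · exact b.2 i (not_lt.1 h1)

lemma IsStair.sum_lt {l t : ℕ} {a b : Fin (m + n) → ℕ} (ha : IsStair l t a) (hb : IsStair l t b)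
    (hac : ∀ i, a i ≤ cap m l t i) (hbc : ∀ i, b i ≤ cap m l t i) {i : Fin (m + n)}
    (hi : a i < b i) : ∑ x, a x < ∑ x, b x := by
  refine Finset.sum_lt_sum (fun x _ => ?_) ⟨i, Finset.mem_univ i, hi⟩
  rcases lt_trichotomy x i with h | rfl | h
  · exact (hb x i h (by omega)).symm ▸ hac x
  · exact hi.le
  · by_contra hlt
    have h1 := ha i x h (by omega)
    have h2 := hbc i
    omega

/-- A staircase is determined by its sum. -/
lemma IsStair.eq_of_sum_eq {l t : ℕ} {a b : Fin (m + n) → ℕ} (ha : IsStair l t a)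
    (hb : IsStair l t b) (hac : ∀ i, a i ≤ cap m l t i) (hbc : ∀ i, b i ≤ cap m l t i)
    (h : ∑ x, a x = ∑ x, b x) : a = b := by
  funext i
  rcases lt_trichotomy (a i) (b i) with h1 | h1 | h1
  · exact absurd h (ha.sum_lt hb hac hbc h1).ne
  · exact h1
  · exact absurd h (hb.sum_lt ha hbc hac h1).ne'

lemma isStair_of_adjacent {l t : ℕ} (hl : l ≠ 1) {b : Fin (m + n) → ℕ}
    (h : ∀ j : Fin (m + n - 1), b (hi j) ≠ 0 → b (lo j) = cap m l t j.1) : IsStair l t b := by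
  have hpos : ∀ i, cap m l t i ≠ 0 := by
    intro i
    rw [cap]
    split_ifs <;> omega
  have key : ∀ d : ℕ, ∀ x y : Fin (m + n), x.1 + d + 1 = y.1 → b y ≠ 0 →
      b x = cap m l t x := by
    intro d
    induction d with
    | zero =>
      intro x y hxy hy
      have hx := y.2
      have e1 : x = lo ⟨x.1, by omega⟩ := rfl
      have e2 : y = hi ⟨x.1, by omega⟩ := Fin.ext hxy.symm
      rw [e2] at hy
      rw [e1]
      exact h _ hy
    | succ d ih =>
      intro x y hxy hy
      have hx := y.2
      have e1 : (⟨y.1 - 1, by omega⟩ : Fin (m + n)) = lo ⟨y.1 - 1, by omega⟩ := rfl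
      have e2 : y = hi ⟨y.1 - 1, by omega⟩ := Fin.ext (show y.1 = y.1 - 1 + 1 by omega)
      refine ih x ⟨y.1 - 1, by omega⟩ (show x.1 + d + 1 = y.1 - 1 by omega) ?_
      rw [e2] at hy
      rw [e1, h _ hy]
      exact hpos _
  intro x y hxy hy
  have hxy' : x.1 < y.1 := hxy
  exact key (y.1 - x.1 - 1) x y (by omega) hy

/-- Every allowed monomial other than the staircase of its degree can be raised by some `E_j`. The
hypothesis `l ≠ 1` makes all caps positive. -/
lemma exists_raisable {l t : ℕ} (hl : l ≠ 1) {b₀ b : Expo m n} (hs : IsStair l t b₀.1)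
    (hb₀ : Allowed l b₀.1) (ht₀ : ∑ i, b₀.1 i = t) (hb : Allowed l b.1) (ht : ∑ i, b.1 i = t)
    (hne : b ≠ b₀) : ∃ (j : Fin (m + n - 1)) (b' : Expo m n), b.1 (hi j) ≠ 0 ∧
      b'.1 = move b.1 (lo j) (hi j) ∧ Allowed l b'.1 := by
  by_contra! hcon
  refine hne (Subtype.ext (IsStair.eq_of_sum_eq (isStair_of_adjacent hl fun j hj => ?_) hs
    (le_cap hb ht) (le_cap hb₀ ht₀) (ht.trans ht₀.symm)))
  by_contra hlo
  have h1 : (lo j).1 = j.1 := rfl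
  have hle := le_cap hb ht (lo j)
  rw [h1] at hle
  have hlt : b.1 (lo j) + 1 ≤ cap m l t j.1 := by omega
  have hval : ∀ i : Fin (m + n), m ≤ i.1 → move b.1 (lo j) (hi j) i ≤ 1 := by
    intro i hi'
    by_cases hx : i = lo j
    · subst hx
      rw [cap, if_neg (by omega)] at hlt
      simpa only [move, Function.update_self] using hlt
    · have := b.2 i hi'
      by_cases hx' : i = hi j
      · subst hx'
        simp only [move, Function.update_of_ne hx, Function.update_self]
        omega
      · simpa only [move, Function.update_of_ne hx, Function.update_of_ne hx'] using this
  refine hcon j ⟨_, hval⟩ hj rfl fun i hi' => ?_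
  rcases hb i hi' with h0 | h0
  · exact Or.inl h0
  · right
    by_cases hx : i = lo j
    · subst hx
      rw [cap, if_pos (by omega), if_neg (by omega)] at hlt
      simp only [move, Function.update_self]
      omega
    · by_cases hx' : i = hi j
      · subst hx'
        simp only [move, Function.update_of_ne hx, Function.update_self]
        omega
      · simpa only [move, Function.update_of_ne hx, Function.update_of_ne hx'] using h0

end Staircases

/-! ### Simplicity of the homogeneous components -/

section Simplicity

variable {k : Type*} [Field k] {q : k} {m n : ℕ} {g : LieType} {l t : ℕ}
  {M : Type*} [AddCommGroup M] [Module k M] [Module (QAlg g l q m n) M]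
  {ι : M →ₗ[k] Omega k m n}

/-- The generators, including the inverses of the torus generators, act through `genOp`. -/
lemma ι_gen_smul [IsScalarTower k (QAlg g l q m n) M] (hq0 : q ≠ 0) (hq : q - q⁻¹ ≠ 0)
    (hact : ActsByOperators q g l M ι) (x : Gen g m n) (y : M) :
    ι (gen g l q m n x • y) = genOp q g x (ι y) := by
  obtain ⟨hE, hF, hT, hs⟩ := hact
  cases x with
  | E j => rw [hE, opE_eq hq0 hq, genOp]
  | F j => rw [hF, opF_eq hq0 hq, genOp]
  | T a => rw [hT, opT_eq hq0, genOp]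
  | Tinv a =>
    have h1 : gen g l q m n (.T a) • gen g l q m n (.Tinv a) • y = y := by
      have h2 : gen g l q m n (.T a) * gen g l q m n (.Tinv a) = 1 := by
        simpa only [map_mul, map_one, mkAlgHom_fTinv, mkAlgHom_fT] using
          mkAlgHom_eq_of_rel (Rel.T_Tinv (l := l) (q := q) a)
      rw [← mul_smul, h2, one_smul]
    conv_rhs => rw [← h1, hT, opT_eq hq0]
    rw [genOp, ← Module.End.mul_apply, ← torusOp_add hq0, neg_add_cancel, torusOp_zero,
      Module.End.one_apply]
  | sigma => rw [hs, genOp]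

/-- The operators of the generators preserve the degree and the restricted subspace. -/
lemma genOp_mem_supported (hl : qInt q l = 0) (x : Gen g m n) {t : ℕ} {y : Omega k m n}
    (hy : y ∈ Finsupp.supported k k {b : Expo m n | Allowed l b.1 ∧ ∑ i, b.1 i = t}) :
    genOp q g x y ∈ Finsupp.supported k k {b : Expo m n | Allowed l b.1 ∧ ∑ i, b.1 i = t} := by
  have key : ∀ {i j : Fin (m + n)}, i ≠ j → (raise q i * lower k j) y ∈
      Finsupp.supported k k {b : Expo m n | Allowed l b.1 ∧ ∑ i, b.1 i = t} := by
    intro i j hij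
    refine Finsupp.supported_mono ?_ (raise_lower_mem_supported (q := q) hij hy)
    rintro b' ⟨b, ⟨hb, ht⟩, hj, hc, hb'⟩
    rw [Set.mem_ofPred_eq, hb']
    exact ⟨allowed_move hl hb hc, (sum_move hij hj).trans ht⟩
  cases x with
  | E j => exact key (lo_ne_hi j)
  | F j => exact key (lo_ne_hi j).symm
  | T a => exact diag_mem_supported _ hy
  | Tinv a => exact diag_mem_supported _ hy
  | sigma => exact diag_mem_supported _ hy

variable [IsScalarTower k (QAlg g l q m n) M]

/-- The degree-`t` part of a module on which the algebra acts by the operators. -/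
lemma exists_submodule_eq_comap_component (hq0 : q ≠ 0) (hq : q - q⁻¹ ≠ 0) (hl : qInt q l = 0)
    (hact : ActsByOperators q g l M ι)
    (hrange : LinearMap.range ι = Finsupp.supported k k {b : Expo m n | Allowed l b.1}) (t : ℕ) :
    ∃ W : Submodule (QAlg g l q m n) M, W.restrictScalars k = (component k m n t).comap ι := by
  have hS : (component k m n t).comap ι = (Finsupp.supported k k
      {b : Expo m n | Allowed l b.1 ∧ ∑ i, b.1 i = t}).comap ι := by
    ext x
    have hx : ι x ∈ Finsupp.supported k k {b : Expo m n | Allowed l b.1} := hrange ▸ ⟨x, rfl⟩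
    rw [Submodule.mem_comap, Submodule.mem_comap, component_eq_supported, Set.ofPred_and,
      Finsupp.supported_inter]
    exact ⟨fun h => ⟨hx, h⟩, fun h => h.2⟩
  refine ⟨{ (component k m n t).comap ι with smul_mem' := fun a x hx => ?_ }, rfl⟩
  refine smul_mem_of_gen_smul_mem (S := (component k m n t).comap ι) (fun x s hs => ?_) a hx
  rw [hS, Submodule.mem_comap] at hs ⊢
  rw [ι_gen_smul hq0 hq hact]
  exact genOp_mem_supported hl x hs

section

variable {W : Submodule (QAlg g l q m n) M} {b₀ : Expo m n} {v : M}

lemma ι_mem_supported_of_mem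
    (hrange : LinearMap.range ι = Finsupp.supported k k {b : Expo m n | Allowed l b.1})
    (hW : W.restrictScalars k = (component k m n t).comap ι) {x : M} (hx : x ∈ W) :
    ι x ∈ Finsupp.supported k k {b : Expo m n | Allowed l b.1 ∧ ∑ i, b.1 i = t} := by
  have h1 : ι x ∈ Finsupp.supported k k {b : Expo m n | Allowed l b.1} := hrange ▸ ⟨x, rfl⟩
  have h2 : x ∈ W.restrictScalars k := hx
  rw [hW, Submodule.mem_comap, component_eq_supported] at h2
  rw [Set.ofPred_and, Finsupp.supported_inter]
  exact ⟨h1, h2⟩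

lemma mem_of_ι_mem (hW : W.restrictScalars k = (component k m n t).comap ι) {x : M}
    (hx : ι x ∈ Finsupp.supported k k {b : Expo m n | ∑ i, b.1 i = t}) : x ∈ W := by
  have h : x ∈ W.restrictScalars k := by
    rw [hW, Submodule.mem_comap, component_eq_supported]
    exact hx
  exact h

lemma mono_mem_component_supported (hb : Allowed l b₀.1) (ht : ∑ i, b₀.1 i = t) :
    mono k b₀.1 ∈ Finsupp.supported k k {b : Expo m n | Allowed l b.1 ∧ ∑ i, b.1 i = t} := by
  refine Finsupp.supported_mono ?_ (mono_mem_supported _)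
  intro b hb'
  rw [Set.mem_ofPred_eq] at hb' ⊢
  rw [hb']
  exact ⟨hb, ht⟩

/-- The staircase has the least height among the allowed monomials of its degree. -/
lemma height_stair_le (hl1 : l ≠ 1) (hs : IsStair l t b₀.1) (hb₀ : Allowed l b₀.1)
    (ht₀ : ∑ i, b₀.1 i = t) (b : Expo m n) (hb : Allowed l b.1) (ht : ∑ i, b.1 i = t) :
    height b₀.1 ≤ height b.1 := by
  induction h : height b.1 using Nat.strong_induction_on generalizing b with
  | _ r ih =>
    by_cases hne : b = b₀
    · rw [← h, hne]
    · obtain ⟨j, b', hj, hb', hal⟩ := exists_raisable hl1 hs hb₀ ht₀ hb ht hne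
      have h1 := height_move_lo_hi (b := b.1) hj
      rw [← hb'] at h1
      have := ih (height b'.1) (by omega) b' hal (by rw [hb', sum_move (lo_ne_hi j) hj, ht]) rfl
      omega

/-- Every nonzero submodule of the component contains the monomial of the staircase: a nonzero
vector whose monomials have the smallest possible heights is killed by all `E_j`. -/
theorem stair_mem_of_ne_bot (hq0 : q ≠ 0) (hq : q - q⁻¹ ≠ 0) (hl : qChar q = l) (hl1 : l ≠ 1)
    (hact : ActsByOperators q g l M ι) (hι : Function.Injective ι)
    (hrange : LinearMap.range ι = Finsupp.supported k k {b : Expo m n | Allowed l b.1})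
    (hW : W.restrictScalars k = (component k m n t).comap ι)
    (hs : IsStair l t b₀.1) (hb₀ : Allowed l b₀.1) (ht₀ : ∑ i, b₀.1 i = t)
    (hv : ι v = mono k b₀.1) {N : Submodule (QAlg g l q m n) M} (hN : N ≤ W) (hN0 : N ≠ ⊥) :
    v ∈ N := by
  classical
  have hex : ∃ r : ℕ, ∃ x ∈ N, x ≠ 0 ∧ ι x ∈ Finsupp.supported k k
      {b : Expo m n | height b.1 ≤ r} := by
    obtain ⟨x, hx, hx0⟩ := Submodule.exists_mem_ne_zero_of_ne_bot hN0
    refine ⟨(ι x).support.sup fun b => height b.1, x, hx, hx0, ?_⟩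
    intro b hb
    exact Finset.le_sup (f := fun b : Expo m n => height b.1) hb
  obtain ⟨x, hxN, hx0, hxr⟩ := Nat.find_spec hex
  have hmin := fun s (hs : s < Nat.find hex) => Nat.find_min hex hs
  generalize Nat.find hex = r at hxr hmin
  have hxW := ι_mem_supported_of_mem hrange hW (hN hxN)
  -- `E_j x` lies in `N` and has smaller heights than `x`, so it vanishes by minimality
  have hkill : ∀ j, gen g l q m n (.E j) • x = 0 := by
    intro j
    by_contra hne
    have hy := raise_lower_mem_supported (q := q) (lo_ne_hi j) hxr
    have hEx : ι (gen g l q m n (.E j) • x) = (raise q (lo j) * lower k (hi j)) (ι x) :=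
      ι_gen_smul hq0 hq hact (.E j) x
    rw [← hEx] at hy
    have hle : ι (gen g l q m n (.E j) • x) ∈ Finsupp.supported k k
        {b : Expo m n | height b.1 + 1 ≤ r} := by
      refine Finsupp.supported_mono ?_ hy
      rintro b' ⟨b, hb, hj, -, hb'⟩
      rw [Set.mem_ofPred_eq, hb', height_move_lo_hi hj]
      exact hb
    have hne' : ι (gen g l q m n (.E j) • x) ≠ 0 := fun h => hne (hι (h.trans (map_zero ι).symm))
    obtain ⟨b', hb'⟩ := Finsupp.support_nonempty_iff.2 hne'
    have hr : height b'.1 + 1 ≤ r := hle hb'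
    refine hmin (r - 1) (by omega) ⟨_, N.smul_mem _ hxN, hne, Finsupp.supported_mono ?_ hle⟩
    intro b (hb : height b.1 + 1 ≤ r)
    exact (show height b.1 ≤ r - 1 by omega)
  -- the coefficient of `E_j x` at a raised monomial is a nonzero multiple of that of `x`
  have hsupp : ∀ b, b ≠ b₀ → ι x b = 0 := by
    intro b hb
    by_contra hxb
    obtain ⟨hal, ht⟩ := hxW (Finsupp.mem_support_iff.2 hxb)
    obtain ⟨j, b', hj, hb', hal'⟩ := exists_raisable hl1 hs hb₀ ht₀ hal ht hb
    have h1 := raise_lower_apply (q := q) (lo_ne_hi j) (ι x) hj hb'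
    have h2 := ι_gen_smul hq0 hq hact (.E j) x
    rw [hkill, map_zero, genOp] at h2
    rw [← h2, Finsupp.zero_apply] at h1
    have h3 : b'.1 (lo j) = b.1 (lo j) + 1 := by rw [hb', move, Function.update_self]
    have h4 := raiseCoeff_ne_zero hl hal' (i := lo j) (by omega)
    rw [h3] at h4
    exact (mul_ne_zero h4 hxb) h1.symm
  have hx : x = ι x b₀ • v := by
    refine hι ?_
    rw [map_smul, hv]
    ext b
    rw [Finsupp.smul_apply, mono_apply]
    by_cases hb : b = b₀
    · subst hb; simp
    · rw [hsupp b hb, if_neg fun h => hb (Subtype.ext h.symm), smul_zero]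
  have hc : ι x b₀ ≠ 0 := fun h => hx0 (by rw [hx, h, zero_smul])
  have hvx : v = (ι x b₀)⁻¹ • x := by
    conv_rhs => rw [hx]
    rw [map_smul, Finsupp.smul_apply, hv, mono_apply, if_pos rfl, smul_eq_mul, mul_one, smul_smul,
      inv_mul_cancel₀ hc, one_smul]
  rw [hvx, ← algebraMap_smul (QAlg g l q m n)]
  exact N.smul_mem _ hxN

/-- The staircase generates the component: every other monomial is a multiple of `F_j` applied to a
monomial of smaller height. -/
theorem eq_span_stair (hq0 : q ≠ 0) (hq : q - q⁻¹ ≠ 0) (hl : qChar q = l) (hl1 : l ≠ 1)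
    (hact : ActsByOperators q g l M ι) (hι : Function.Injective ι)
    (hrange : LinearMap.range ι = Finsupp.supported k k {b : Expo m n | Allowed l b.1})
    (hW : W.restrictScalars k = (component k m n t).comap ι)
    (hs : IsStair l t b₀.1) (hb₀ : Allowed l b₀.1) (ht₀ : ∑ i, b₀.1 i = t)
    (hv : ι v = mono k b₀.1) : W = Submodule.span (QAlg g l q m n) {v} := by
  refine le_antisymm (fun x hx => ?_) ?_
  · let S : Submodule k (Omega k m n) :=
      ((Submodule.span (QAlg g l q m n) {v}).restrictScalars k).map ι
    have key : ∀ (r : ℕ) (b : Expo m n), height b.1 = r → Allowed l b.1 → ∑ i, b.1 i = t →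
        mono k b.1 ∈ S := by
      intro r
      induction r using Nat.strong_induction_on with
      | _ r ih =>
        intro b hr hal ht
        by_cases hb : b = b₀
        · rw [hb, ← hv]
          exact ⟨v, Submodule.mem_span_singleton_self v, rfl⟩
        · obtain ⟨j, b', hj, hb', hal'⟩ := exists_raisable hl1 hs hb₀ ht₀ hal ht hb
          have h1 := height_move_lo_hi (b := b.1) hj
          rw [← hb'] at h1
          have hsum : ∑ i, b'.1 i = t := by rw [hb', sum_move (lo_ne_hi j) hj, ht]
          obtain ⟨y, hy, hy'⟩ := ih (height b'.1) (by omega) b' rfl hal' hsum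
          have hlo : b'.1 (lo j) ≠ 0 := by
            rw [hb', move, Function.update_self]
            exact Nat.succ_ne_zero _
          have hhi : b'.1 (hi j) + 1 = b.1 (hi j) := by
            rw [hb', move, Function.update_of_ne (lo_ne_hi j).symm, Function.update_self]
            omega
          have hlc : lowerCoeff k (lo j) (b'.1 (lo j)) = 1 := by
            have := b'.2 (lo j)
            rw [lowerCoeff, if_neg (by omega)]
          have h2 := ι_gen_smul hq0 hq hact (.F j) y
          rw [hy', genOp, raise_mul_lower_mono_of_ne (lo_ne_hi j).symm, hlc, one_mul, hhi, hb',
            move_move (lo_ne_hi j) hj] at h2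
          have hc := raiseCoeff_ne_zero hl hal hj
          have h3 : mono k b.1 = (raiseCoeff q (hi j) (b.1 (hi j)))⁻¹ •
              ι (gen g l q m n (.F j) • y) := by
            rw [h2, smul_smul, inv_mul_cancel₀ hc, one_smul]
          rw [h3]
          exact S.smul_mem _ ⟨gen g l q m n (.F j) • y,
            Submodule.smul_mem (Submodule.span (QAlg g l q m n) {v}) _ hy, rfl⟩
    have hxS : ι x ∈ S := by
      have h := ι_mem_supported_of_mem hrange hW hx
      exact apply_mem_of_forall_mono (f := 1) (S := S) (fun b hb => key _ b rfl hb.1 hb.2) h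
    obtain ⟨y, hy, hyx⟩ := hxS
    rw [← hι hyx]
    exact hy
  · rw [Submodule.span_singleton_le_iff_mem]
    refine mem_of_ι_mem hW ?_
    rw [hv]
    exact Finsupp.supported_mono (fun b hb => hb.2) (mono_mem_component_supported hb₀ ht₀)

lemma isHighestWeightVector_stair (hq0 : q ≠ 0) (hq : q - q⁻¹ ≠ 0) (hl : qInt q l = 0)
    (hl1 : l ≠ 1) (hact : ActsByOperators q g l M ι) (hι : Function.Injective ι)
    (hs : IsStair l t b₀.1) (hb₀ : Allowed l b₀.1) (ht₀ : ∑ i, b₀.1 i = t)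
    (hv : ι v = mono k b₀.1) :
    IsHighestWeightVector g l q m n (expoWeight b₀.1) v := by
  refine ⟨?_, fun j => ?_, fun a => ?_, ?_⟩
  · rintro rfl
    have h := DFunLike.congr_fun hv b₀
    rw [map_zero, mono_apply, if_pos rfl] at h
    exact zero_ne_one h
  · by_contra hne
    have hne' : ι (gen g l q m n (.E j) • v) ≠ 0 := fun h => hne (hι (h.trans (map_zero ι).symm))
    obtain ⟨b', hb'⟩ := Finsupp.support_nonempty_iff.2 hne'
    rw [ι_gen_smul hq0 hq hact, hv] at hb'
    obtain ⟨b, hb, hj, hc, hbm⟩ := raise_lower_mem_supported (q := q) (lo_ne_hi j)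
      (mono_mem_supported b₀.1) hb'
    rw [show b = b₀ from Subtype.ext hb] at hj hc hbm
    have h1 := height_move_lo_hi (b := b₀.1) hj
    rw [← hbm] at h1
    have h2 := height_stair_le hl1 hs hb₀ ht₀ b' (hbm ▸ allowed_move hl hb₀ hc)
      (by rw [hbm, sum_move (lo_ne_hi j) hj, ht₀])
    omega
  · refine hι ?_
    rw [ι_gen_smul hq0 hq hact, hv, genOp, torusOp_mono, map_smul, hv]
  · refine hι ?_
    rw [ι_gen_smul hq0 hq hact, hv, genOp, opParity_mono, map_smul, hv,
      neg_one_pow_eq_zpow_oddDegree]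

/-- A product of `r` operators `F_j` raises the height of a monomial by `r`. -/
lemma ι_fWord_smul_mem (hq0 : q ≠ 0) (hq : q - q⁻¹ ≠ 0) (hact : ActsByOperators q g l M ι)
    (hv : ι v = mono k b₀.1) (w : List (Fin (m + n - 1))) :
    ι (fWord g l q m n w • v) ∈ Finsupp.supported k k
      {b : Expo m n | height b.1 = height b₀.1 + w.length} := by
  induction w with
  | nil =>
    rw [fWord_nil_smul, hv]
    refine Finsupp.supported_mono ?_ (mono_mem_supported _)
    intro b (hb : b.1 = b₀.1)
    exact congrArg height hb
  | cons j w ih =>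
    rw [fWord_cons_smul, ι_gen_smul hq0 hq hact]
    refine Finsupp.supported_mono ?_ (raise_lower_mem_supported (q := q) (lo_ne_hi j).symm ih)
    rintro b' ⟨b, hb, hj, -, hb'⟩
    have hb1 : height b.1 = height b₀.1 + w.length := hb
    rw [Set.mem_ofPred_eq, hb', height_move_hi_lo hj, hb1, List.length_cons, add_assoc]

/-- A homogeneous component that contains the monomial of a staircase `b₀` is the simple highest
weight module with highest weight `b₀`. -/
theorem isSimpleHighestWeight_stair (hq0 : q ≠ 0) (hq : q - q⁻¹ ≠ 0) (hl : qChar q = l)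
    (hl1 : l ≠ 1) (hact : ActsByOperators q g l M ι) (hι : Function.Injective ι)
    (hrange : LinearMap.range ι = Finsupp.supported k k {b : Expo m n | Allowed l b.1})
    (hW : W.restrictScalars k = (component k m n t).comap ι)
    (hs : IsStair l t b₀.1) (hb₀ : Allowed l b₀.1) (ht₀ : ∑ i, b₀.1 i = t)
    (hv : ι v = mono k b₀.1) :
    IsSimpleHighestWeight g l q m n W v (expoWeight b₀.1) := by
  have hhw := isHighestWeightVector_stair hq0 hq (qInt_qChar hl) hl1 hact hι hs hb₀ ht₀ hv
  have hspan := eq_span_stair hq0 hq hl hl1 hact hι hrange hW hs hb₀ ht₀ hv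
  have hvW : v ∈ W := hspan ▸ Submodule.mem_span_singleton_self v
  have hsimple : IsSimpleModule (QAlg g l q m n) W := by
    rw [isSimpleModule_iff_isAtom]
    refine ⟨fun h => hhw.1 ?_, fun N hN => ?_⟩
    · rw [h] at hvW
      exact (Submodule.mem_bot _).1 hvW
    · by_contra hN0
      have h := stair_mem_of_ne_bot hq0 hq hl hl1 hact hι hrange hW hs hb₀ ht₀ hv hN.le hN0
      refine hN.not_ge ?_
      rw [hspan, Submodule.span_singleton_le_iff_mem]
      exact h
  refine ⟨hsimple, hhw, hspan, ?_⟩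
  subst hspan
  refine nonempty_equiv_V hq0 hhw ((Finsupp.lapply b₀ : Omega k m n →ₗ[k] k) ∘ₗ ι) ?_
    fun w hw => ?_
  · rw [LinearMap.comp_apply, hv, Finsupp.lapply_apply, mono_apply, if_pos rfl]
    exact one_ne_zero
  · rw [LinearMap.comp_apply, Finsupp.lapply_apply]
    by_contra hne
    have h : height b₀.1 = height b₀.1 + w.length :=
      ι_fWord_smul_mem hq0 hq hact hv w (Finsupp.mem_support_iff.2 hne)
    have := List.length_pos_iff.2 hw
    omega

end

end Simplicity

/-! ### The module structures and the highest weights -/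

section ModuleStructures

variable {k A E : Type*} [Field k] [Ring A] [Algebra k A] [AddCommGroup E] [Module k E]

/-- The module structure given by a representation. -/
abbrev moduleOfRep (ρ : A →ₐ[k] Module.End k E) : Module A E :=
  Module.compHom E (ρ : A →+* Module.End k E)

lemma isScalarTower_moduleOfRep (ρ : A →ₐ[k] Module.End k E) :
    let _ := moduleOfRep ρ
    IsScalarTower k A E :=
  letI := moduleOfRep ρ
  ⟨fun c a x => by
    change ρ (c • a) x = c • ρ a x
    rw [map_smul, LinearMap.smul_apply]⟩

/-- The module structure on a subspace that is invariant under a representation. -/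
abbrev moduleOfInvariant (ρ : A →ₐ[k] Module.End k E) (P : Submodule k E)
    (h : ∀ a, ∀ x ∈ P, ρ a x ∈ P) : Module A P where
  smul a x := ⟨ρ a x, h a x x.2⟩
  one_smul x := Subtype.ext (by change ρ 1 (x : E) = x; rw [map_one]; rfl)
  mul_smul a b x := Subtype.ext (by
    change ρ (a * b) (x : E) = ρ a (ρ b x); rw [map_mul]; rfl)
  smul_zero a := Subtype.ext (by change ρ a (0 : E) = 0; rw [map_zero])
  smul_add a x y := Subtype.ext (by
    change ρ a ((x : E) + y) = ρ a x + ρ a y; rw [map_add])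
  add_smul a b x := Subtype.ext (by
    change ρ (a + b) (x : E) = ρ a x + ρ b x; rw [map_add]; rfl)
  zero_smul x := Subtype.ext (by change ρ 0 (x : E) = 0; rw [map_zero]; rfl)

lemma isScalarTower_moduleOfInvariant (ρ : A →ₐ[k] Module.End k E) (P : Submodule k E)
    (h : ∀ a, ∀ x ∈ P, ρ a x ∈ P) :
    letI := moduleOfInvariant ρ P h
    IsScalarTower k A P :=
  letI := moduleOfInvariant ρ P h
  ⟨fun c a x => Subtype.ext (by
    change ρ (c • a) (x : E) = c • ρ a x
    rw [map_smul, LinearMap.smul_apply])⟩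

end ModuleStructures

section HighestWeights

variable {k : Type*} [Field k] {q : k} {m n : ℕ}

lemma omegaRep_mem_restricted (hq0 : q ≠ 0) (hq : q - q⁻¹ ≠ 0) (g : LieType) {l : ℕ}
    (hl : qInt q l = 0) (hl2 : l = 0 ∨ 2 ≤ l) (hl0 : 0 < l) (a : QAlg g l q m n)
    (x : Omega k m n) (hx : x ∈ restricted k l m n) :
    omegaRep hq0 hq g hl hl2 a x ∈ restricted k l m n := by
  let _ := moduleOfRep (omegaRep (m := m) (n := n) hq0 hq g hl hl2)
  have _ := isScalarTower_moduleOfRep (omegaRep (m := m) (n := n) hq0 hq g hl hl2)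
  refine smul_mem_of_gen_smul_mem (S := restricted k l m n) (fun y s hs => ?_) a hx
  change omegaRep hq0 hq g hl hl2 (gen g l q m n y) s ∈ _
  rw [omegaRep_gen]
  rw [restricted_eq_supported hl0] at hs ⊢
  refine apply_mem_of_forall_mono (fun b hb => ?_) hs
  exact Finsupp.supported_mono (fun b hb => hb.1)
    (genOp_mem_supported hl y (mono_mem_component_supported hb rfl))

lemma stairExpo_valid {l r s : ℕ} (hr : r < m) :
    ∀ i : Fin (m + n), m ≤ i.1 → stairExpo l m n r s i ≤ 1 := by
  intro i hi'
  rw [stairExpo, if_neg (by omega), if_neg (by omega)]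
  exact Nat.zero_le _

lemma topExpo_valid {l p : ℕ} : ∀ i : Fin (m + n), m ≤ i.1 → topExpo l m n p i ≤ 1 := by
  intro i hi'
  rw [topExpo, if_neg (by omega)]
  split_ifs <;> simp

lemma sum_stairExpo {l r s : ℕ} (hr : r < m) :
    ∑ i, stairExpo l m n r s i = r * (l - 1) + s := by
  have h : ∀ i : Fin (m + n), stairExpo l m n r s i =
      (if i.1 < r then l - 1 else 0) + if i = ⟨r, by omega⟩ then s else 0 := by
    intro i
    simp only [stairExpo, Fin.ext_iff]
    split_ifs <;> omega
  rw [Finset.sum_congr rfl fun i _ => h i, Finset.sum_add_distrib, Finset.sum_ite_eq',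
    if_pos (Finset.mem_univ _), ← Finset.sum_filter, Finset.sum_const, smul_eq_mul,
    Fin.card_filter_val_lt, min_eq_right (by omega)]

lemma sum_topExpo {l p : ℕ} (hp : p ≤ n) :
    ∑ i, topExpo l m n p i = m * (l - 1) + p := by
  rw [Fin.sum_univ_add]
  congr 1
  · simp [topExpo]
  · have h : ∀ i : Fin n, topExpo l m n p (Fin.natAdd m i) = if i.1 < p then 1 else 0 := by
      intro i
      simp [topExpo]
    rw [Finset.sum_congr rfl fun i _ => h i, Finset.sum_boole, Fin.card_filter_val_lt,
      min_eq_right hp, Nat.cast_id]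

lemma single_valid (hm : 0 < m) (h0 : 0 < m + n) (t : ℕ) : ∀ i : Fin (m + n), m ≤ i.1 →
    (Pi.single (⟨0, h0⟩ : Fin (m + n)) t : Fin (m + n) → ℕ) i ≤ 1 := by
  intro i hi'
  rw [Pi.single_eq_of_ne (fun h => by rw [h] at hi'; simp at hi'; omega)]
  exact Nat.zero_le _

lemma expoWeight_single (h0 : 0 < m + n) (t : ℕ) :
    expoWeight (Pi.single (⟨0, h0⟩ : Fin (m + n)) t : Fin (m + n) → ℕ) =
      (t : ℤ) • fundWeight m n 1 := by
  funext i
  simp only [expoWeight, fundWeight, Pi.smul_apply, Pi.single_apply, Fin.ext_iff, smul_eq_mul]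
  split_ifs <;> omega

lemma expoWeight_stairExpo {l r s : ℕ} (hl : 0 < l) :
    expoWeight (stairExpo l m n r s) =
      (((l : ℤ) - 1 - s) • fundWeight m n r + (s : ℤ) • fundWeight m n (r + 1)) := by
  funext i
  simp only [expoWeight, stairExpo, fundWeight, Pi.add_apply, Pi.smul_apply, smul_eq_mul]
  split_ifs <;> push_cast <;> omega

lemma expoWeight_topExpo {l p : ℕ} (hl : 0 < l) :
    expoWeight (topExpo l m n p) =
      (((l : ℤ) - 2) • fundWeight m n m + fundWeight m n (m + p)) := by
  funext i
  simp only [expoWeight, topExpo, fundWeight, Pi.add_apply, Pi.smul_apply, smul_eq_mul]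
  split_ifs <;> push_cast <;> omega

end HighestWeights

end QGrassmann
end

theorem theorem28 {k : Type*} [Field k] [IsAlgClosed k] [CharZero k] (m n : ℕ) (q : k)
    (hq0 : q ≠ 0) (hq1 : q ≠ 1) (hq2 : q ≠ -1) (g : LieType) :
    -- the full algebra acting on `Ω_q(m|n)`
    (∃ (_ : Module (QAlg g 0 q m n) (Omega k m n))
        (_ : IsScalarTower k (QAlg g 0 q m n) (Omega k m n)),
      ActsByOperators q g 0 (Omega k m n) LinearMap.id ∧
      ∀ t : ℕ, ∃ W : Submodule (QAlg g 0 q m n) (Omega k m n),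
        W.restrictScalars k = component k m n t ∧
        (qChar q = 0 → ∀ hm : 0 < m,
          IsSimpleHighestWeight g 0 q m n W
            (mono k (Pi.single (⟨0, by omega⟩ : Fin (m + n)) t))
            ((t : ℤ) • fundWeight m n 1))) ∧
    -- the restricted algebra acting on `Ω_q(m|n, 1)`
    (∀ l : ℕ, qChar q = l → 2 < l →
      ∃ (_ : Module (QAlg g l q m n) (restricted k l m n))
        (_ : IsScalarTower k (QAlg g l q m n) (restricted k l m n)),
      ActsByOperators q g l (restricted k l m n) (restricted k l m n).subtype ∧
      ∀ t : ℕ, ∃ W : Submodule (QAlg g l q m n) (restricted k l m n),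
        W.restrictScalars k = restrictedComponent k l m n t ∧
        (∀ i s : ℕ, 1 ≤ i → i ≤ m → s ≤ l - 1 → t = (i - 1) * (l - 1) + s →
          ∃ v : restricted k l m n, (v : Omega k m n) = mono k (stairExpo l m n (i - 1) s) ∧
            IsSimpleHighestWeight g l q m n W v
              (((l : ℤ) - 1 - s) • fundWeight m n (i - 1) + (s : ℤ) • fundWeight m n i)) ∧
        (∀ p : ℕ, p ≤ n → t = m * (l - 1) + p →
          ∃ v : restricted k l m n, (v : Omega k m n) = mono k (topExpo l m n p) ∧
            IsSimpleHighestWeight g l q m n W v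
              (((l : ℤ) - 2) • fundWeight m n m + fundWeight m n (m + p)))) := by
  have hq := sub_inv_ne_zero_of_ne hq0 hq1 hq2
  constructor
  · let ρ : QAlg g 0 q m n →ₐ[k] Module.End k (Omega k m n) :=
      omegaRep hq0 hq g qInt_zero (Or.inl rfl)
    let _ := moduleOfRep ρ
    have _ := isScalarTower_moduleOfRep ρ
    have hgen : ∀ (x : Gen g m n) (y : Omega k m n), gen g 0 q m n x • y = genOp q g x y :=
      fun x y => congrArg (fun f : Module.End k (Omega k m n) => f y)
        (omegaRep_gen hq0 hq g qInt_zero (Or.inl rfl) x)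
    have hact : ActsByOperators q g 0 (Omega k m n) LinearMap.id := by
      refine ⟨fun j x => ?_, fun j x => ?_, fun a x => ?_, fun x => ?_⟩
      · rw [LinearMap.id_apply, LinearMap.id_apply, hgen, opE_eq hq0 hq, genOp]
      · rw [LinearMap.id_apply, LinearMap.id_apply, hgen, opF_eq hq0 hq, genOp]
      · rw [LinearMap.id_apply, LinearMap.id_apply, hgen, opT_eq hq0, genOp]
      · rw [LinearMap.id_apply, LinearMap.id_apply, hgen, genOp]
    have hrange : LinearMap.range (LinearMap.id : Omega k m n →ₗ[k] Omega k m n) =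
        Finsupp.supported k k {b : Expo m n | Allowed 0 b.1} := by
      have h : {b : Expo m n | Allowed 0 b.1} = Set.univ :=
        Set.eq_univ_of_forall fun b i _ => Or.inl rfl
      rw [h, Finsupp.supported_univ, LinearMap.range_id]
    refine ⟨inferInstance, inferInstance, hact, fun t => ?_⟩
    obtain ⟨W, hW⟩ := exists_submodule_eq_comap_component hq0 hq qInt_zero hact hrange t
    refine ⟨W, hW.trans (Submodule.comap_id _), fun hchar hm => ?_⟩
    rw [← expoWeight_single (Nat.add_pos_left hm n)]
    refine isSimpleHighestWeight_stair (b₀ := ⟨_, single_valid hm (Nat.add_pos_left hm n) t⟩) hq0 hq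
      hchar (by omega) hact Function.injective_id hrange hW ?_ (fun i _ => Or.inl rfl) (by simp) rfl
    intro x y hxy hy
    have hy0 : y ≠ ⟨0, by omega⟩ := fun h => by
      rw [h, Fin.lt_def] at hxy
      exact Nat.not_lt_zero _ hxy
    exact absurd (Pi.single_eq_of_ne hy0 _) hy
  · intro l hchar hl
    have hl0 : 0 < l := by omega
    have hql := qInt_qChar hchar
    let ρ : QAlg g l q m n →ₐ[k] Module.End k (Omega k m n) :=
      omegaRep hq0 hq g hql (Or.inr hl.le)
    have hinv := omegaRep_mem_restricted (m := m) (n := n) hq0 hq g hql (Or.inr hl.le) hl0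
    let _ := moduleOfInvariant ρ (restricted k l m n) hinv
    have _ := isScalarTower_moduleOfInvariant ρ (restricted k l m n) hinv
    have hgen : ∀ (x : Gen g m n) (y : restricted k l m n),
        (restricted k l m n).subtype (gen g l q m n x • y) =
          genOp q g x ((restricted k l m n).subtype y) :=
      fun x y => congrArg (fun f : Module.End k (Omega k m n) => f y)
        (omegaRep_gen hq0 hq g hql (Or.inr hl.le) x)
    have hact : ActsByOperators q g l (restricted k l m n) (restricted k l m n).subtype := by
      refine ⟨fun j x => ?_, fun j x => ?_, fun a x => ?_, fun x => ?_⟩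
      · rw [hgen, opE_eq hq0 hq, genOp]
      · rw [hgen, opF_eq hq0 hq, genOp]
      · rw [hgen, opT_eq hq0, genOp]
      · rw [hgen, genOp]
    have hrange : LinearMap.range (restricted k l m n).subtype =
        Finsupp.supported k k {b : Expo m n | Allowed l b.1} := by
      rw [Submodule.range_subtype, restricted_eq_supported hl0]
    have hinj := (restricted k l m n).injective_subtype
    refine ⟨inferInstance, inferInstance, hact, fun t => ?_⟩
    obtain ⟨W, hW⟩ := exists_submodule_eq_comap_component hq0 hq hql hact hrange t
    have main : ∀ b : Expo m n, Allowed l b.1 → ∑ i, b.1 i = t → IsStair l t b.1 →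
        ∃ v : restricted k l m n, (v : Omega k m n) = mono k b.1 ∧
          IsSimpleHighestWeight g l q m n W v (expoWeight b.1) := by
      intro b hb ht hs
      have hmem : mono k b.1 ∈ restricted k l m n := by
        rw [restricted_eq_supported hl0]
        exact Finsupp.supported_mono (fun b hb => hb.1) (mono_mem_component_supported hb ht)
      exact ⟨⟨_, hmem⟩, rfl, isSimpleHighestWeight_stair hq0 hq hchar (by omega) hact hinj hrange hW
        hs hb ht rfl⟩
    refine ⟨W, hW, fun i s hi him hs ht => ?_, fun p hp ht => ?_⟩
    · obtain ⟨r, rfl⟩ : ∃ r, i = r + 1 := ⟨i - 1, by omega⟩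
      rw [Nat.add_sub_cancel] at ht ⊢
      rw [← expoWeight_stairExpo hl0]
      refine main ⟨_, stairExpo_valid him⟩ ?_ ((sum_stairExpo him).trans ht.symm) ?_
      · intro x hx
        right
        simp only [stairExpo]
        split_ifs <;> omega
      · intro x y hxy hy
        have hxy' : x.1 < y.1 := hxy
        simp only [stairExpo, cap] at hy ⊢
        split_ifs at hy ⊢ <;> omega
    · rw [← expoWeight_topExpo hl0]
      refine main ⟨_, topExpo_valid⟩ ?_ ((sum_topExpo hp).trans ht.symm) ?_
      · intro x hx
        right
        simp only [topExpo]
        split_ifs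
        omega
      · intro x y hxy hy
        have hxy' : x.1 < y.1 := hxy
        simp only [topExpo, cap] at hy ⊢
        split_ifs at hy ⊢ <;> omega
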